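/- Let $n\ge 1$, let $\mathbb B_n$ be the open unit ball of $\mathbb C^n$ with Lebesgue volume measure $V$ (write $|E|=V(E)$), and let $b:\mathbb B_n\to\mathbb C$ be holomorphic. Let $P$ be the Bergman projection, i.e. the orthogonal projection of $L^2(\mathbb B_n)$ onto its closed subspace $A^2(\mathbb B_n)$ of holomorphic square-integrable functions; on $L^1(\mathbb B_n)$, let $P$ denote the integral operator $$Pf(z)=\frac{n!}{\pi^n}\int_{\mathbb B_n}\frac{f(w)}{(1-\langle z,w\rangle)^{n+1}}\,dV(w),\qquad z\in\mathbb B_n,\quad \langle z,w\rangle=\sum_{j=1}^n z_j\overline{w_j},$$ and set $[\bar b,P]f=\bar b\,Pf-P(\bar b f)$. Then the following are equivalent: 1. $[\bar b,P]$, with $P$ the orthogonal projection, is weak-type $(1,1)$ on its natural domain in $L^2$: there is $C>0$ such that for all $f\in L^2(\mathbb B_n)$ with $\bar b f\in L^2(\mathbb B_n)$ and all $\lambda>0$, $$|\{z\in\mathbb B_n: |[\bar b,P]f(z)|>\lambda\}|\le \frac{C}{\lambda}\int_{\mathbb B_n}|f|\,dV.$$ 2. $[\bar b,P]$, with $P$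 the integral operator, is weak-type $(1,1)$ on its natural domain in $L^1$: there is $C>0$ such that the same inequality holds for all $f\in L^1(\mathbb B_n)$ with $\bar b f\in L^1(\mathbb B_n)$ and all $\lambda>0$. 3. $b\in H^\infty(\mathbb B_n)$, i.e. $b$ is bounded on $\mathbb B_n$. -/

import Mathlib

open MeasureTheory Metric
open scoped ENNReal ComplexConjugate Nat

/-- Complex Euclidean space of dimension `n`, with the Hermitian norm. -/
abbrev Cn (n : ℕ) : Type := EuclideanSpace ℂ (Fin n)

/-- The open unit ball of `ℂⁿ`. -/
abbrev unitBall (n : ℕ) : Set (Cn n) := ball 0 1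

/-- Lebesgue volume measure of `ℂⁿ`, restricted to the unit ball. -/
noncomputable abbrev ballVolume (n : ℕ) : Measure (Cn n) := volume.restrict (unitBall n)

/-- `L²` of the unit ball with respect to Lebesgue measure. -/
abbrev BallL2 (n : ℕ) : Type := Lp ℂ 2 (ballVolume n)

/-- The Bergman space: the classes in `L²` of the unit ball that have a representative which is
holomorphic on the unit ball. -/
noncomputable def bergmanSpace (n : ℕ) : Submodule ℂ (BallL2 n) where
  carrier := {f | ∃ g : Cn n → ℂ, DifferentiableOn ℂ g (unitBall n) ∧ f =ᵐ[ballVolume n] g}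
  add_mem' := by
    rintro f₁ f₂ ⟨g₁, h₁, e₁⟩ ⟨g₂, h₂, e₂⟩
    exact ⟨g₁ + g₂, h₁.add h₂, (Lp.coeFn_add f₁ f₂).trans (e₁.add e₂)⟩
  zero_mem' := ⟨0, differentiableOn_const 0, Lp.coeFn_zero ℂ 2 (ballVolume n)⟩
  smul_mem' := by
    rintro c f ⟨g, h, e⟩
    exact ⟨c • g, h.const_smul c, (Lp.coeFn_smul c f).trans (e.const_smul c)⟩

/-- The Bergman projection: the orthogonal projection of `L²` of the unit ball onto the Bergman
space.  The Bergman space is a closed subspace, so it coincides with its topological closure; the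
closure is written only because the orthogonal projection onto it exists without further proof. -/
noncomputable def bergmanProjection (n : ℕ) : BallL2 n →L[ℂ] BallL2 n :=
  (bergmanSpace n).topologicalClosure.starProjection

/-- The Bergman integral operator
`Pf(z) = (n! / πⁿ) ∫ f(w) / (1 - ⟨z, w⟩) ^ (n + 1) dV(w)`, where `⟨z, w⟩ = ∑ zⱼ * conj wⱼ`
(Mathlib's inner product is conjugate-linear in its first argument).  For `f` integrable over the
ball the integral converges absolutely at every `z` in the ball. -/
noncomputable def bergmanIntegral (n : ℕ) (f : Cn n → ℂ) (z : Cn n) : ℂ :=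
  ((n ! : ℂ) / (Real.pi : ℂ) ^ n) *
    ∫ w, f w / (1 - inner ℂ w z) ^ (n + 1) ∂(ballVolume n)

/-- The function `T` on the ball satisfies the weak-`L¹` estimate with constant `C` relative to
the function `f`: `|{z ∈ 𝔹ₙ : |T z| > t}| ≤ (C / t) ∫ |f| dV` for all `t > 0`. -/
def WeakBound (n : ℕ) (C : ℝ) (f T : Cn n → ℂ) : Prop :=
  ∀ t : ℝ, 0 < t →
    ballVolume n {z | t < ‖T z‖} ≤ ENNReal.ofReal (C / t) * ∫⁻ z, ‖f z‖ₑ ∂(ballVolume n)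

/-- The commutator `[a, P] f = a * P f - P (a * f)` with `P` the orthogonal projection, for `f`
in its natural domain in `L²`: both `f` and `a * f` are square integrable. -/
noncomputable def commutatorL2 (n : ℕ) (a f : Cn n → ℂ) (hf : MemLp f 2 (ballVolume n))
    (haf : MemLp (fun z => a z * f z) 2 (ballVolume n)) : Cn n → ℂ :=
  fun z => a z * bergmanProjection n (hf.toLp f) z -
    bergmanProjection n (haf.toLp (fun z => a z * f z)) z

/-- `[a, P]`, as an operator densely defined on `L²`, is weak-type (1,1). -/
def CommutatorWeakTypeL2 (n : ℕ) (a : Cn n → ℂ) : Prop :=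
  ∃ C : ℝ, 0 < C ∧ ∀ (f : Cn n → ℂ) (hf : MemLp f 2 (ballVolume n))
    (haf : MemLp (fun z => a z * f z) 2 (ballVolume n)),
    WeakBound n C f (commutatorL2 n a f hf haf)

/-- The commutator `[a, P] f = a * P f - P (a * f)` with `P` the Bergman integral operator. -/
noncomputable def commutatorL1 (n : ℕ) (a f : Cn n → ℂ) : Cn n → ℂ :=
  fun z => a z * bergmanIntegral n f z - bergmanIntegral n (fun w => a w * f w) z

/-- `[a, P]`, as an operator on its natural domain in `L¹` (both `f` and `a * f` are integrable),
is weak-type (1,1). -/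
def CommutatorWeakTypeL1 (n : ℕ) (a : Cn n → ℂ) : Prop :=
  ∃ C : ℝ, 0 < C ∧ ∀ f : Cn n → ℂ, Integrable f (ballVolume n) →
    Integrable (fun z => a z * f z) (ballVolume n) → WeakBound n C f (commutatorL1 n a f)

/-- `b` belongs to `H^∞` of the unit ball: it is holomorphic and bounded there. -/
def MemHInfinity (n : ℕ) (b : Cn n → ℂ) : Prop :=
  DifferentiableOn ℂ b (unitBall n) ∧ ∃ M : ℝ, ∀ z ∈ unitBall n, ‖b z‖ ≤ M

/-! Boundedness suffices because the two terms of the commutator are separately of weak type (1,1).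
The estimate for `P` holds for the positive kernel `|1 - ⟨z, w⟩|^{-(n+1)}`, so no smoothness or
cancellation of the kernel is needed. Let `N` be averaging over nonisotropic tents. The positive
operator is pointwise at most a constant times `N* N` (`exists_bergmanPositive_le`). A Vitali
covering shows that the tents with average above `t` have a union `Ω` of volume `O(‖f‖₁ / t)`
(`exists_volume_iUnion_tent_le`). Off `Ω`, `N* N f` equals `N* h`, where `h` is `N f` cut off above
height `t`. Both `h` and `N 1_G`, with `G = {N* h > t}`, are bounded and in weak `L¹`, hence have
controlled `L²` norms. Pairing them bounds `t |G|`, with a term in `|G|` that is absorbed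
(`exists_weakType_bergmanPositive`).

The `L¹` statement implies the `L²` one because the orthogonal projection agrees almost everywhere
with the integral operator (`bergmanProjection_ae_eq`). This rests on the reproducing formula,
obtained from the mean value property at the centre by an automorphism of the ball.

Boundedness is necessary by testing on the indicator of a small ball `B` centred at `a`. The kernel
is antiholomorphic in `w`, and so is the symbol, so the mean value property computes the commutator
exactly: a constant times `|B| conj (b z - b a) / (1 - ⟨z, a⟩)^{n+1}` (`commutatorL1_indicator`). If
`|b a|` were too large, this would be large on the whole ball of radius `1/2`, against the weak
bound. -/

/-! ### The nonisotropic gauge on the ball -/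

/-- The nonisotropic gauge `|1 - ⟨z, w⟩|`. -/
noncomputable def hermGauge {n : ℕ} (z w : Cn n) : ℝ := ‖1 - inner ℂ w z‖

theorem hermGauge_comm {n : ℕ} (z w : Cn n) : hermGauge z w = hermGauge w z := by
  unfold hermGauge
  rw [← RCLike.norm_conj, map_sub, map_one, inner_conj_symm]

theorem norm_inner_lt_one {n : ℕ} {z w : Cn n} (hz : ‖z‖ < 1) (hw : ‖w‖ < 1) :
    ‖inner ℂ w z‖ < 1 := by
  have := norm_inner_le_norm (𝕜 := ℂ) w z
  nlinarith [norm_nonneg z, norm_nonneg w]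

theorem norm_inner_le_left {n : ℕ} {z w : Cn n} (hw : ‖w‖ < 1) : ‖inner ℂ w z‖ ≤ ‖z‖ := by
  have := norm_inner_le_norm (𝕜 := ℂ) w z
  nlinarith [norm_nonneg z, norm_nonneg w]

theorem one_sub_norm_le_hermGauge {n : ℕ} {z w : Cn n} (hw : ‖w‖ < 1) : 1 - ‖z‖ ≤ hermGauge z w := by
  have h1 := norm_inner_le_left (z := z) hw
  have h2 := norm_sub_norm_le (1 : ℂ) (inner ℂ w z)
  rw [norm_one] at h2
  unfold hermGauge
  linarith

theorem hermGauge_pos {n : ℕ} {z w : Cn n} (hz : ‖z‖ < 1) (hw : ‖w‖ < 1) : 0 < hermGauge z w := by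
  have := one_sub_norm_le_hermGauge (z := z) hw
  linarith

theorem one_sub_inner_ne_zero {n : ℕ} {z w : Cn n} (hz : ‖z‖ < 1) (hw : ‖w‖ < 1) :
    1 - inner ℂ w z ≠ 0 := norm_pos_iff.1 (hermGauge_pos hz hw)

theorem hermGauge_le_two {n : ℕ} {z w : Cn n} (hz : ‖z‖ < 1) (hw : ‖w‖ < 1) : hermGauge z w ≤ 2 := by
  have h1 := norm_inner_lt_one hz hw
  have h2 := norm_sub_le (1 : ℂ) (inner ℂ w z)
  rw [norm_one] at h2
  unfold hermGauge
  linarith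

theorem one_sub_sq_le_two_mul_hermGauge {n : ℕ} {z w : Cn n} (hz : ‖z‖ < 1) (hw : ‖w‖ < 1) :
    1 - ‖z‖ ^ 2 ≤ 2 * hermGauge z w := by
  have := one_sub_norm_le_hermGauge (z := z) hw
  nlinarith [norm_nonneg z]

theorem hermGauge_self {n : ℕ} {z : Cn n} (hz : ‖z‖ < 1) : hermGauge z z = 1 - ‖z‖ ^ 2 := by
  unfold hermGauge
  rw [inner_self_eq_norm_sq_to_K]
  have h : (1 : ℂ) - (‖z‖ : ℂ) ^ 2 = ((1 - ‖z‖ ^ 2 : ℝ) : ℂ) := by push_cast; ring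
  change ‖(1 : ℂ) - (‖z‖ : ℂ) ^ 2‖ = _
  rw [h, Complex.norm_real, Real.norm_of_nonneg]
  nlinarith [norm_nonneg z]

/-- Expanding the square gives `‖z‖² + ‖w‖² - 2 Re ⟨z, w⟩ ≤ 2 (1 - Re ⟨z, w⟩)`. This controls the
cross term in the quasi-triangle inequality. -/
theorem norm_sub_sq_le_two_mul_hermGauge {n : ℕ} {z w : Cn n} (hz : ‖z‖ < 1) (hw : ‖w‖ < 1) :
    ‖z - w‖ ^ 2 ≤ 2 * hermGauge z w := by
  have h1 := norm_sub_sq (𝕜 := ℂ) w z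
  have h2 : 1 - (inner ℂ w z).re ≤ hermGauge z w := by
    have := Complex.re_le_norm (1 - inner ℂ w z)
    simpa [hermGauge] using this
  have h3 : RCLike.re (inner ℂ w z) = (inner ℂ w z).re := rfl
  rw [norm_sub_rev, h1, h3]
  nlinarith [norm_nonneg z, norm_nonneg w]

/-- Inserting `w` in both slots leaves a product of Euclidean distances, handled by AM-GM, and the
defect `1 - ‖w‖²`. The defect is at most twice each of the two gauges, hence at most their sum. The
three contributions give the constant 3. -/
theorem hermGauge_triangle {n : ℕ} {z w u : Cn n} (hz : ‖z‖ < 1) (hw : ‖w‖ < 1) (hu : ‖u‖ < 1) :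
    hermGauge z u ≤ 3 * (hermGauge z w + hermGauge w u) := by
  have key : 1 - inner ℂ u z = (1 - inner ℂ w z) + inner ℂ (w - u) (z - w) +
      ((1 - inner ℂ u w) - (1 - inner ℂ w w)) := by
    simp only [inner_sub_left, inner_sub_right]; ring
  have h1 : ‖inner ℂ (w - u) (z - w)‖ ≤ hermGauge z w + hermGauge w u := by
    have h := norm_inner_le_norm (𝕜 := ℂ) (w - u) (z - w)
    have a := norm_sub_sq_le_two_mul_hermGauge hz hw
    have b := norm_sub_sq_le_two_mul_hermGauge hw hu
    nlinarith [sq_nonneg (‖z - w‖ - ‖w - u‖)]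
  have h2 : ‖(1 - inner ℂ u w) - (1 - inner ℂ w w)‖ ≤ hermGauge w u + hermGauge w w := norm_sub_le _ _
  have h3 := hermGauge_self hw
  have h4 := one_sub_sq_le_two_mul_hermGauge hw hz
  have h5 := one_sub_sq_le_two_mul_hermGauge hw hu
  rw [hermGauge_comm w z] at h4
  have h6 : hermGauge z u ≤ hermGauge z w + ‖inner ℂ (w - u) (z - w)‖ +
      ‖(1 - inner ℂ u w) - (1 - inner ℂ w w)‖ := by
    unfold hermGauge
    rw [key]
    exact norm_add₃_le
  linarith

theorem continuous_hermGauge {n : ℕ} : Continuous fun p : Cn n × Cn n => hermGauge p.1 p.2 := by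
  unfold hermGauge
  fun_prop

/-! ### Unitary coordinates and volumes -/

theorem exists_unitary_apply_eq_single {n : ℕ} [NeZero n] (z : Cn n) :
    ∃ U : Cn n ≃ₗᵢ[ℂ] Cn n, U z = EuclideanSpace.single 0 (‖z‖ : ℂ) := by
  by_cases hz : z = 0
  · exact ⟨LinearIsometryEquiv.refl ℂ _, by ext i; simp [hz]⟩
  have hz' : (‖z‖ : ℂ) ≠ 0 := by simpa using hz
  obtain ⟨b, hb⟩ := Orthonormal.exists_orthonormalBasis_extension_of_card_eq (𝕜 := ℂ) (E := Cn n)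
    (ι := Fin n) (by simp) (v := fun _ => (‖z‖ : ℂ)⁻¹ • z) (s := {0}) (by
      rw [orthonormal_iff_ite]
      rintro ⟨i, rfl⟩ ⟨j, rfl⟩
      have h : ‖(‖z‖ : ℂ)⁻¹ • z‖ = 1 := by
        rw [norm_smul, norm_inv, Complex.norm_real, norm_norm, inv_mul_cancel₀]
        simpa using hz
      simp only [Set.domRestrict_apply, if_true]
      rw [inner_self_eq_norm_sq_to_K, h]
      simp)
  refine ⟨b.repr, ?_⟩
  have h0 : z = (‖z‖ : ℂ) • b 0 := by
    rw [hb 0 rfl, smul_smul, mul_inv_cancel₀ hz', one_smul]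
  conv_lhs => rw [h0]
  rw [map_smul, b.repr_self]
  ext i
  simp

theorem measurePreserving_unitary {n : ℕ} (U : Cn n ≃ₗᵢ[ℂ] Cn n) :
    MeasurePreserving U (volume : Measure (Cn n)) volume :=
  LinearIsometryEquiv.measurePreserving
    (⟨U.toLinearEquiv.restrictScalars ℝ, U.norm_map⟩ : Cn n ≃ₗᵢ[ℝ] Cn n)

/-- By uniqueness of Haar measure the Euclidean volume is a positive multiple of the product volume.
The value of the ratio is never needed. -/
theorem exists_volume_polydisc (n : ℕ) : ∃ c : ℝ, 0 < c ∧ ∀ (p : Fin n → ℂ) (r : Fin n → ℝ),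
    volume {w : Cn n | ∀ i, ‖w i - p i‖ < r i} = ENNReal.ofReal c * ∏ i, ENNReal.ofReal (r i) ^ 2 := by
  let e : Cn n ≃L[ℝ] (Fin n → ℂ) := (PiLp.continuousLinearEquiv 2 ℝ (fun _ : Fin n => ℂ))
  have hae : (Measure.map e (volume : Measure (Cn n))).IsAddHaarMeasure :=
    e.isAddHaarMeasure_map volume
  have hc := Measure.isAddLeftInvariant_eq_smul (Measure.map e volume) (volume : Measure (Fin n → ℂ))
  set c := (Measure.map e (volume : Measure (Cn n))).addHaarScalarFactor volume with hcdef
  have hc0 : 0 < c := Measure.addHaarScalarFactor_pos_of_isAddHaarMeasure _ _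
  refine ⟨c * Real.pi ^ n, by positivity, fun p r => ?_⟩
  have h1 : {w : Cn n | ∀ i, ‖w i - p i‖ < r i} = e ⁻¹' (Set.univ.pi fun i => ball (p i) (r i)) := by
    ext w
    simp [e, dist_eq_norm]
  rw [h1, ← Measure.map_apply e.continuous.measurable
    (MeasurableSet.univ_pi fun i => measurableSet_ball), hc, Measure.smul_apply, volume_pi_pi]
  simp only [Complex.volume_ball, Finset.prod_mul_distrib, Finset.prod_const, Finset.card_univ,
    Fintype.card_fin, ENNReal.smul_def, smul_eq_mul]
  rw [ENNReal.ofReal_mul (by positivity), ENNReal.ofReal_pow Real.pi_pos.le,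
    ENNReal.ofReal_coe_nnreal, ← NNReal.coe_real_pi, ENNReal.ofReal_coe_nnreal]
  ring

theorem inner_eq_of_unitary {n : ℕ} [NeZero n] {z : Cn n} {U : Cn n ≃ₗᵢ[ℂ] Cn n}
    (hU : U z = EuclideanSpace.single 0 (‖z‖ : ℂ)) (w : Cn n) :
    inner ℂ z w = ‖z‖ * (U w) 0 := by
  rw [← U.inner_map_map, hU, EuclideanSpace.inner_single_left]
  simp

theorem hermGauge_eq_of_unitary {n : ℕ} [NeZero n] {z : Cn n} {U : Cn n ≃ₗᵢ[ℂ] Cn n}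
    (hU : U z = EuclideanSpace.single 0 (‖z‖ : ℂ)) (w : Cn n) :
    hermGauge z w = ‖1 - (‖z‖ : ℂ) * (U w) 0‖ := by
  rw [hermGauge_comm, hermGauge, inner_eq_of_unitary hU]

/-- This and the next bound compare `1 - ρ c` with `1 - c` up to `1 - ρ`. At scales not below the
defect of the centre, the centre may thus be moved to the sphere. -/
theorem norm_one_sub_mul_le {ρ : ℝ} (h0 : 0 ≤ ρ) (h1 : ρ ≤ 1) (c : ℂ) :
    ‖1 - (ρ : ℂ) * c‖ ≤ (1 - ρ) + ‖1 - c‖ := by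
  have h : 1 - (ρ : ℂ) * c = ((1 - ρ : ℝ) : ℂ) + ρ * (1 - c) := by push_cast; ring
  rw [h]
  refine (norm_add_le _ _).trans ?_
  rw [norm_mul, Complex.norm_real, Complex.norm_real, Real.norm_of_nonneg h0,
    Real.norm_of_nonneg (by linarith)]
  nlinarith [norm_nonneg (1 - c)]

theorem norm_one_sub_le {ρ : ℝ} (h1 : ρ ≤ 1) {c : ℂ} (hc : ‖c‖ ≤ 1) :
    ‖1 - c‖ ≤ (1 - ρ) + ‖1 - (ρ : ℂ) * c‖ := by
  have h : 1 - c = (1 - (ρ : ℂ) * c) - ((1 - ρ : ℝ) : ℂ) * c := by push_cast; ring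
  rw [h]
  refine (norm_sub_le _ _).trans ?_
  rw [norm_mul, Complex.norm_real, Real.norm_of_nonneg (by linarith)]
  nlinarith [norm_nonneg c]

theorem norm_sq_coord_add_le {n : ℕ} (w : Cn n) {i j : Fin n} (hij : i ≠ j) :
    ‖w i‖ ^ 2 + ‖w j‖ ^ 2 ≤ ‖w‖ ^ 2 := by
  rw [EuclideanSpace.norm_sq_eq, ← Finset.sum_pair hij (f := fun k => ‖w k‖ ^ 2)]
  exact Finset.sum_le_sum_of_subset_of_nonneg (Finset.subset_univ _) fun _ _ _ => sq_nonneg _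

/-- The complex normal direction has radius of order `R` and contributes `R²`. Each of the `n - 1`
tangential ones has radius of order `√R` and contributes `R`. The exponent is `2 + (n - 1) = n + 1`.
-/
theorem prod_anisotropic_radius (n : ℕ) [NeZero n] {a b R : ℝ} (ha : 0 ≤ a) (hb : 0 ≤ b)
    (hR : 0 ≤ R) :
    ∏ i : Fin n, ENNReal.ofReal (if i = 0 then a * R else b * √R) ^ 2 =
      ENNReal.ofReal (a ^ 2 * b ^ (2 * (n - 1)) * R ^ (n + 1)) := by
  have h : ∀ i : Fin n, ENNReal.ofReal (if i = 0 then a * R else b * √R) ^ 2 =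
      ENNReal.ofReal ((if i = 0 then a ^ 2 * R else b ^ 2) * R) := by
    intro i
    rw [← ENNReal.ofReal_pow (by split_ifs <;> positivity)]
    congr 1
    split_ifs
    · ring
    · rw [mul_pow, Real.sq_sqrt hR]
  rw [Finset.prod_congr rfl fun i _ => h i,
    ← ENNReal.ofReal_prod_of_nonneg fun i _ => by split_ifs <;> positivity,
    Finset.prod_mul_distrib, Finset.prod_const, ← Finset.mul_prod_erase _ _ (Finset.mem_univ 0),
    if_pos rfl, Finset.prod_congr rfl (g := fun _ => b ^ 2)
      (fun i hi => if_neg (Finset.ne_of_mem_erase hi)), Finset.prod_const,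
    Finset.card_erase_of_mem (Finset.mem_univ _), Finset.card_univ, Fintype.card_fin]
  congr 1
  rw [← pow_mul, pow_succ R]
  ring

/-- Nonisotropic balls of radius at least the defect `1 - |x|²` of the centre have volume at most
a multiple of the radius to the power `n + 1`. -/
theorem exists_volume_hermGauge_ball_le (n : ℕ) [NeZero n] : ∃ C : ℝ, 0 < C ∧
    ∀ (x : Cn n) (R : ℝ), ‖x‖ < 1 → 1 - ‖x‖ ^ 2 ≤ R →
      ballVolume n {w | hermGauge x w < R} ≤ ENNReal.ofReal (C * R ^ (n + 1)) := by
  obtain ⟨c, hc, hv⟩ := exists_volume_polydisc n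
  refine ⟨c * (2 ^ 2 * 2 ^ (2 * (n - 1))), by positivity, fun x R hx hR => ?_⟩
  have hR0 : 0 < R := by nlinarith [norm_nonneg x]
  obtain ⟨U, hU⟩ := exists_unitary_apply_eq_single x
  have hsub : {w | hermGauge x w < R} ∩ unitBall n ⊆
      U ⁻¹' {w : Cn n | ∀ i, ‖w i - (if i = 0 then 1 else 0)‖ <
        if i = 0 then 2 * R else 2 * √R} := by
    rintro w ⟨hw, hwB⟩ i
    rw [Set.mem_ofPred_eq, hermGauge_eq_of_unitary hU] at hw
    have hUw : ‖U w‖ < 1 := by rw [U.norm_map]; simpa using hwB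
    have h0 : ‖(U w) 0‖ ≤ 1 := (PiLp.norm_apply_le (U w) 0).trans hUw.le
    have h1 : ‖1 - (U w) 0‖ < 2 * R := by
      have := norm_one_sub_le hx.le h0
      nlinarith [norm_nonneg x]
    by_cases hi : i = 0
    · subst hi
      simpa [norm_sub_rev] using h1
    · simp only [hi, if_false, sub_zero]
      have h2 := norm_sq_coord_add_le (U w) hi
      have h3 : 1 - ‖(U w) 0‖ ≤ ‖1 - (U w) 0‖ := by
        simpa using norm_sub_norm_le (1 : ℂ) ((U w) 0)
      -- Inside the unit ball, `|w_i|² < 1 - |w_0|² ≤ 2 (1 - |w_0|) < 4 R`.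
      have h4 : ‖(U w) i‖ ^ 2 < (2 * √R) ^ 2 := by
        rw [mul_pow, Real.sq_sqrt hR0.le]
        nlinarith [norm_nonneg (U w), norm_nonneg ((U w) 0)]
      exact lt_of_pow_lt_pow_left₀ 2 (by positivity) h4
  rw [Measure.restrict_apply (by
    exact (isOpen_lt (continuous_hermGauge.comp (by fun_prop : Continuous fun w => (x, w)))
      continuous_const).measurableSet)]
  refine (measure_mono hsub).trans ?_
  rw [(measurePreserving_unitary U).measure_preimage_emb
    U.toHomeomorph.measurableEmbedding, hv,
    prod_anisotropic_radius n (by norm_num) (by norm_num) hR0.le,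
    ← ENNReal.ofReal_mul hc.le, mul_assoc c]

/-- A nonisotropic ball contains a region of comparable volume on which the defect is comparable to
the radius. -/
theorem exists_le_volume_interior_region (n : ℕ) [NeZero n] : ∃ c : ℝ, 0 < c ∧
    ∀ (z : Cn n) (δ : ℝ), ‖z‖ < 1 → 1 - ‖z‖ ^ 2 ≤ 4 * δ → δ ≤ 1 →
      ENNReal.ofReal (c * δ ^ (n + 1)) ≤ ballVolume n
        {x | hermGauge x z ≤ 6 * δ ∧ δ ≤ 4 * (1 - ‖x‖ ^ 2) ∧ 1 - ‖x‖ ^ 2 ≤ 3 * δ} := by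
  obtain ⟨c, hc, hv⟩ := exists_volume_polydisc n
  have hn : (0 : ℝ) < n := by exact_mod_cast Nat.pos_of_ne_zero (NeZero.ne n)
  have hs : 0 < √(1 / (4 * n : ℝ)) := Real.sqrt_pos.2 (by positivity)
  refine ⟨c * ((1 / 2) ^ 2 * √(1 / (4 * n : ℝ)) ^ (2 * (n - 1))), by positivity,
    fun z δ hz hδ hδ1 => ?_⟩
  have hδ0 : 0 < δ := by nlinarith [norm_nonneg z]
  obtain ⟨U, hU⟩ := exists_unitary_apply_eq_single z
  -- A polydisc about `(1 - δ) e₀`. The factor `1 / (4n)` keeps the squared tangential coordinates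
  -- below `δ / 4` in total, leaving a defect of order `δ`.
  set S : Set (Cn n) := {w | ∀ i, ‖w i - (if i = 0 then ((1 - δ : ℝ) : ℂ) else 0)‖ <
    if i = 0 then 1 / 2 * δ else √(1 / (4 * n : ℝ)) * √δ} with hS
  have hbase : ∀ x ∈ U ⁻¹' S, δ ≤ 4 * (1 - ‖x‖ ^ 2) ∧ 1 - ‖x‖ ^ 2 ≤ 3 * δ ∧
      hermGauge x z ≤ 6 * δ := by
    intro x hx
    have hx0 : ‖(U x) 0 - ((1 - δ : ℝ) : ℂ)‖ < 1 / 2 * δ := by simpa using hx 0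
    have h1 : ‖(U x) 0‖ < 1 - δ / 2 := by
      have := norm_sub_norm_le ((U x) 0) ((1 - δ : ℝ) : ℂ)
      rw [Complex.norm_real, Real.norm_of_nonneg (by linarith)] at this
      linarith
    have h2 : ‖1 - (U x) 0‖ < 3 / 2 * δ := by
      have h : 1 - (U x) 0 = (δ : ℂ) - ((U x) 0 - ((1 - δ : ℝ) : ℂ)) := by push_cast; ring
      rw [h]
      refine (norm_sub_le _ _).trans_lt ?_
      rw [Complex.norm_real, Real.norm_of_nonneg hδ0.le]
      linarith
    have h3 : ‖x‖ ^ 2 ≤ ‖(U x) 0‖ ^ 2 + δ / 4 := by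
      rw [← U.norm_map, EuclideanSpace.norm_sq_eq, ← Finset.add_sum_erase _ _ (Finset.mem_univ 0)]
      gcongr
      have h : ∀ i ∈ Finset.univ.erase (0 : Fin n), ‖(U x) i‖ ^ 2 ≤ δ / (4 * n) := by
        intro i hi
        have hi' := Finset.ne_of_mem_erase hi
        have h := hx i
        simp only [hi', if_false, sub_zero] at h
        calc ‖(U x) i‖ ^ 2 ≤ (√(1 / (4 * n : ℝ)) * √δ) ^ 2 := by gcongr
          _ = δ / (4 * n) := by
            rw [mul_pow, Real.sq_sqrt hδ0.le, Real.sq_sqrt (by positivity)]; ring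
      refine (Finset.sum_le_card_nsmul _ _ _ h).trans ?_
      rw [Finset.card_erase_of_mem (Finset.mem_univ _), Finset.card_univ, Fintype.card_fin,
        nsmul_eq_mul]
      calc ((n - 1 : ℕ) : ℝ) * (δ / (4 * n)) ≤ n * (δ / (4 * n)) := by
            gcongr; exact Nat.sub_le _ _
        _ = δ / 4 := by field_simp
    have h4 : 1 - ‖(U x) 0‖ ≤ ‖1 - (U x) 0‖ := by
      simpa using norm_sub_norm_le (1 : ℂ) ((U x) 0)
    have h5 : ‖(U x) 0‖ ≤ ‖x‖ := (PiLp.norm_apply_le (U x) 0).trans_eq (U.norm_map x)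
    refine ⟨by nlinarith [norm_nonneg ((U x) 0)], by nlinarith [norm_nonneg ((U x) 0)], ?_⟩
    rw [hermGauge_comm, hermGauge_eq_of_unitary hU]
    have := norm_one_sub_mul_le (norm_nonneg z) hz.le ((U x) 0)
    nlinarith [norm_nonneg z]
  have hsub : U ⁻¹' S ⊆ {x | hermGauge x z ≤ 6 * δ ∧ δ ≤ 4 * (1 - ‖x‖ ^ 2) ∧
      1 - ‖x‖ ^ 2 ≤ 3 * δ} ∩ unitBall n := by
    intro x hx
    obtain ⟨h1, h2, h3⟩ := hbase x hx
    refine ⟨⟨h3, h1, h2⟩, ?_⟩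
    rw [mem_ball_zero_iff]
    nlinarith [norm_nonneg x]
  refine le_trans (le_of_eq ?_) ((measure_mono hsub).trans (Measure.le_restrict_apply _ _))
  rw [(measurePreserving_unitary U).measure_preimage_emb
    U.toHomeomorph.measurableEmbedding, hS, hv,
    prod_anisotropic_radius n (by norm_num) hs.le hδ0.le,
    ← ENNReal.ofReal_mul hc.le, mul_assoc c]

/-! ### Averages over nonisotropic tents -/

/-- The tent with vertex `x`. -/
def tent {n : ℕ} (x : Cn n) : Set (Cn n) := {w | hermGauge x w < 100 * (1 - ‖x‖ ^ 2)}

open Classical in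
/-- The normalised indicator function of the tent with vertex `x`. -/
noncomputable def tentKernel {n : ℕ} (x w : Cn n) : ℝ≥0∞ :=
  if w ∈ tent x then (ENNReal.ofReal ((1 - ‖x‖ ^ 2) ^ (n + 1)))⁻¹ else 0

/-- The averages of `f` over tents. -/
noncomputable def tentAverage {n : ℕ} (f : Cn n → ℝ≥0∞) (x : Cn n) : ℝ≥0∞ :=
  ∫⁻ w, tentKernel x w * f w ∂(ballVolume n)

/-- The adjoint of `tentAverage`. -/
noncomputable def tentAdjoint {n : ℕ} (h : Cn n → ℝ≥0∞) (z : Cn n) : ℝ≥0∞ :=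
  ∫⁻ x, tentKernel x z * h x ∂(ballVolume n)

theorem isOpen_tent {n : ℕ} (x : Cn n) : IsOpen (tent x) := by
  have h : Continuous fun w => hermGauge x w := by
    unfold hermGauge
    fun_prop
  exact isOpen_Iio.preimage h

theorem measurable_tentKernel (n : ℕ) :
    Measurable (Function.uncurry (tentKernel : Cn n → Cn n → ℝ≥0∞)) := by
  classical
  have h : MeasurableSet {p : Cn n × Cn n | p.2 ∈ tent p.1} :=
    (isOpen_lt continuous_hermGauge (by fun_prop)).measurableSet
  have : Function.uncurry (tentKernel : Cn n → Cn n → ℝ≥0∞) = fun p =>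
    if p ∈ {p : Cn n × Cn n | p.2 ∈ tent p.1} then
      (ENNReal.ofReal ((1 - ‖p.1‖ ^ 2) ^ (n + 1)))⁻¹ else 0 := by
    ext ⟨x, w⟩
    simp only [Function.uncurry, tentKernel]
    rfl
  rw [this]
  exact Measurable.ite h (by fun_prop) measurable_const

theorem measurable_tentAverage {n : ℕ} {f : Cn n → ℝ≥0∞} (hf : Measurable f) :
    Measurable (tentAverage f) :=
  Measurable.lintegral_prod_right
    ((measurable_tentKernel n).mul (hf.comp measurable_snd) :)

theorem measurable_tentAdjoint {n : ℕ} {h : Cn n → ℝ≥0∞} (hh : Measurable h) :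
    Measurable (tentAdjoint h) :=
  Measurable.lintegral_prod_left
    ((measurable_tentKernel n).mul (hh.comp measurable_fst) :)

theorem ae_norm_lt_one (n : ℕ) : ∀ᵐ x ∂(ballVolume n), ‖x‖ < 1 := by
  filter_upwards [ae_restrict_mem measurableSet_ball] with x hx
  simpa using hx

theorem lintegral_mul_tentAverage {n : ℕ} {f h : Cn n → ℝ≥0∞} (hf : Measurable f)
    (hh : Measurable h) :
    ∫⁻ x, h x * tentAverage f x ∂(ballVolume n) =
      ∫⁻ z, tentAdjoint h z * f z ∂(ballVolume n) := by
  have hk := measurable_tentKernel n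
  have h1 : ∀ x, h x * tentAverage f x =
      ∫⁻ w, h x * (tentKernel x w * f w) ∂(ballVolume n) := fun x =>
    (lintegral_const_mul _ ((hk.comp measurable_prodMk_left).mul hf)).symm
  have h2 : ∀ z, tentAdjoint h z * f z =
      ∫⁻ x, h x * (tentKernel x z * f z) ∂(ballVolume n) := fun z => by
    unfold tentAdjoint
    rw [← lintegral_mul_const (f z) (f := fun x => tentKernel x z * h x)
      ((hk.comp measurable_prodMk_right).mul hh)]
    exact lintegral_congr fun x => by ring
  simp_rw [h1, h2]
  exact lintegral_lintegral_swap (((hh.comp measurable_fst).mul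
    (hk.mul (hf.comp measurable_snd))).aemeasurable)

theorem tentAverage_eq {n : ℕ} (f : Cn n → ℝ≥0∞) {x : Cn n} (hx : ‖x‖ < 1) :
    tentAverage f x = (ENNReal.ofReal ((1 - ‖x‖ ^ 2) ^ (n + 1)))⁻¹ *
      ∫⁻ w in tent x, f w ∂(ballVolume n) := by
  classical
  have hs : 0 < 1 - ‖x‖ ^ 2 := by nlinarith [norm_nonneg x]
  rw [← lintegral_indicator (isOpen_tent x).measurableSet,
    ← lintegral_const_mul' _ _ (by simp; positivity)]
  refine lintegral_congr fun w => ?_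
  unfold tentKernel
  by_cases hw : w ∈ tent x <;> simp [hw]

/-- The tents on which `f` has a large average cover a set of controlled volume. -/
theorem exists_volume_iUnion_tent_le (n : ℕ) [NeZero n] : ∃ C : NNReal, 0 < C ∧
    ∀ (f : Cn n → ℝ≥0∞) (t : ℝ≥0∞),
      t * ballVolume n (⋃ x ∈ {x : Cn n | ‖x‖ < 1 ∧ t < tentAverage f x}, tent x) ≤
        C * ∫⁻ w, f w ∂(ballVolume n) := by
  obtain ⟨C, hC, hvol⟩ := exists_volume_hermGauge_ball_le n
  obtain ⟨K, hK⟩ : ∃ K : ℝ, K = C * 3900 ^ (n + 1) := ⟨_, rfl⟩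
  have hK0 : 0 < K := by rw [hK]; positivity
  refine ⟨K.toNNReal, by positivity, fun f t => ?_⟩
  set F := {x : Cn n | ‖x‖ < 1 ∧ t < tentAverage f x} with hF
  have hpos : ∀ x ∈ F, 0 < 1 - ‖x‖ ^ 2 := fun x hx => by
    have := hx.1
    nlinarith [norm_nonneg x]
  have hmem : ∀ x ∈ F, x ∈ tent x ∩ unitBall n := fun x hx => by
    refine ⟨?_, by simpa using hx.1⟩
    change hermGauge x x < _
    rw [hermGauge_self hx.1]
    linarith [hpos x hx]
  -- With factor 2, each discarded tent meets a selected one whose vertex has at least half its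
  -- defect.
  obtain ⟨u, huF, hdisj, hcov⟩ := Vitali.exists_disjoint_subfamily_covering_enlargement
    (fun x : Cn n => tent x ∩ unitBall n) F (fun x => 1 - ‖x‖ ^ 2) 2 one_lt_two
    (fun x hx => (hpos x hx).le) 1 (fun x _ => by nlinarith [norm_nonneg x])
    (fun x hx => ⟨x, hmem x hx⟩)
  have hcount : u.Countable := hdisj.countable_of_isOpen
    (fun x _ => (isOpen_tent x).inter isOpen_ball) (fun x hx => ⟨x, hmem x (huF hx)⟩)
  have hsub : (⋃ x ∈ F, tent x) ∩ unitBall n ⊆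
      ⋃ b ∈ u, {w | hermGauge b w < 3900 * (1 - ‖b‖ ^ 2)} := by
    rintro w ⟨hw, hwB⟩
    obtain ⟨a, haF, hwa⟩ := Set.mem_iUnion₂.1 hw
    obtain ⟨b, hbu, ⟨y, ⟨hya, hyB⟩, hyb, -⟩, hab⟩ := hcov a haF
    refine Set.mem_iUnion₂.2 ⟨b, hbu, ?_⟩
    rw [mem_ball_zero_iff] at hwB hyB
    change hermGauge a w < _ at hwa
    change hermGauge a y < _ at hya
    change hermGauge b y < _ at hyb
    change hermGauge b w < _
    -- Two triangle inequalities: `3 (100 + 3 (100 + 100) · 2) = 3900`, the 2 being the Vitali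
    -- factor.
    have h1 := hermGauge_triangle (huF hbu).1 hyB hwB
    have h2 := hermGauge_triangle hyB haF.1 hwB
    rw [hermGauge_comm y a] at h2
    linarith [hpos b (huF hbu)]
  have hmu : ballVolume n (⋃ x ∈ F, tent x) ≤
      ∑' b : u, ENNReal.ofReal (C * (3900 * (1 - ‖(b : Cn n)‖ ^ 2)) ^ (n + 1)) := by
    have h1 : ballVolume n (⋃ x ∈ F, tent x) ≤
        ballVolume n (⋃ b ∈ u, {w | hermGauge b w < 3900 * (1 - ‖b‖ ^ 2)}) := by
      refine measure_mono_ae ?_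
      filter_upwards [ae_norm_lt_one n] with w hw hwF
      exact hsub ⟨hwF, by simpa using hw⟩
    refine h1.trans ((measure_biUnion_le _ hcount _).trans (ENNReal.tsum_le_tsum fun b => ?_))
    exact hvol _ _ (huF b.2).1 (by linarith [hpos b (huF b.2)])
  have hterm : ∀ b : u, t * ENNReal.ofReal (C * (3900 * (1 - ‖(b : Cn n)‖ ^ 2)) ^ (n + 1)) ≤
      ENNReal.ofReal K *
        ∫⁻ w in tent (b : Cn n) ∩ unitBall n, f w ∂(ballVolume n) := by
    intro b
    have hb := hpos b (huF b.2)
    have h1 := (huF b.2).2.le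
    rw [tentAverage_eq f (huF b.2).1] at h1
    have hae : ∫⁻ w in tent (b : Cn n), f w ∂(ballVolume n) =
        ∫⁻ w in tent (b : Cn n) ∩ unitBall n, f w ∂(ballVolume n) := by
      refine setLIntegral_congr ?_
      filter_upwards [ae_norm_lt_one n] with w hw
      exact propext ⟨fun h => ⟨h, by simpa using hw⟩, fun h => h.1⟩
    rw [hae] at h1
    rw [mul_pow, ← mul_assoc, ← hK, ENNReal.ofReal_mul hK0.le, mul_left_comm]
    gcongr
    calc t * ENNReal.ofReal ((1 - ‖(b : Cn n)‖ ^ 2) ^ (n + 1)) ≤ _ := mul_le_mul_left h1 _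
      _ = _ := by
        rw [mul_comm, ← mul_assoc, ENNReal.mul_inv_cancel (by simp; positivity) (by simp), one_mul]
  calc t * ballVolume n (⋃ x ∈ F, tent x) ≤
        t * ∑' b : u, ENNReal.ofReal (C * (3900 * (1 - ‖(b : Cn n)‖ ^ 2)) ^ (n + 1)) := by gcongr
    _ ≤ ∑' b : u, ENNReal.ofReal K *
        ∫⁻ w in tent (b : Cn n) ∩ unitBall n, f w ∂(ballVolume n) := by
      rw [← ENNReal.tsum_mul_left]
      exact ENNReal.tsum_le_tsum hterm
    _ = ENNReal.ofReal K *
        ∫⁻ w in ⋃ b ∈ u, tent b ∩ unitBall n, f w ∂(ballVolume n) := by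
      rw [ENNReal.tsum_mul_left, lintegral_biUnion hcount
        (fun b _ => ((isOpen_tent b).inter isOpen_ball).measurableSet) hdisj]
    _ ≤ _ := by
      exact mul_le_mul_right (lintegral_mono' Measure.restrict_le_self le_rfl) _

/-- The second moment, truncated at height `A`, of a function in weak `L¹`. -/
theorem lintegral_sq_truncate_le {α : Type*} [MeasurableSpace α] {μ : Measure α} {u : α → ℝ≥0∞}
    (hu : Measurable u) {K : ℝ≥0∞} (hK : ∀ t : ℝ, 0 < t →
      ENNReal.ofReal t * μ {x | ENNReal.ofReal t < u x} ≤ K) {A : ℝ} (hA : 0 ≤ A) :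
    ∫⁻ x, {x | u x ≤ ENNReal.ofReal A}.indicator u x ^ 2 ∂μ ≤ 2 * ENNReal.ofReal A * K := by
  set v : α → ℝ≥0∞ := {x | u x ≤ ENNReal.ofReal A}.indicator u with hv
  have hvm : Measurable v := hu.indicator (measurableSet_le hu measurable_const)
  have hvA : ∀ x, v x ≤ ENNReal.ofReal A := fun x => by
    by_cases h : u x ≤ ENNReal.ofReal A <;> simp [hv, h]
  have hvt : ∀ x, v x ≠ ⊤ := fun x => ne_top_of_le_ne_top ENNReal.ofReal_ne_top (hvA x)
  -- Layer cake: the integral is `2 ∫ t μ{v > t} dt`, where the integrand is at most `K` for `t < A`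
  -- and vanishes beyond.
  have hlc := lintegral_rpow_eq_lintegral_meas_lt_mul (f := fun x => (v x).toReal) (p := 2) μ
    (ae_of_all _ fun x => ENNReal.toReal_nonneg) hvm.ennreal_toReal.aemeasurable (by norm_num)
  have h1 : ∀ x, ENNReal.ofReal ((v x).toReal ^ (2 : ℝ)) = v x ^ 2 := fun x => by
    rw [Real.rpow_two, ENNReal.ofReal_pow ENNReal.toReal_nonneg, ENNReal.ofReal_toReal (hvt x)]
  simp_rw [h1] at hlc
  rw [hlc]
  have h2 : ∀ t ∈ Set.Ioi (0 : ℝ), μ {a | t < (v a).toReal} * ENNReal.ofReal (t ^ ((2 : ℝ) - 1)) ≤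
      (Set.Ioo 0 A).indicator (fun _ => K) t := by
    intro t ht
    have ht0 : 0 < t := ht
    have hsub : {a | t < (v a).toReal} ⊆ {x | ENNReal.ofReal t < u x} := fun a ha => by
      have h3 : ENNReal.ofReal t < v a := (ENNReal.ofReal_lt_iff_lt_toReal ht0.le (hvt a)).2 ha
      exact h3.trans_le (Set.indicator_le_self _ _ a)
    by_cases htA : t < A
    · rw [Set.indicator_of_mem (Set.mem_Ioo.2 ⟨ht0, htA⟩)]
      have : (2 : ℝ) - 1 = 1 := by norm_num
      rw [this, Real.rpow_one, mul_comm]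
      exact (mul_le_mul_right (measure_mono hsub) _).trans (hK t ht0)
    · have : {a | t < (v a).toReal} = ∅ := by
        ext a
        simp only [Set.mem_ofPred_eq, Set.mem_empty_iff_false, iff_false, not_lt]
        exact (ENNReal.toReal_le_of_le_ofReal hA (hvA a)).trans (not_lt.1 htA)
      simp [this]
  calc ENNReal.ofReal 2 * _ ≤ ENNReal.ofReal 2 *
        ∫⁻ t in Set.Ioi (0 : ℝ), (Set.Ioo 0 A).indicator (fun _ => K) t := by
        gcongr 1
        exact setLIntegral_mono_ae' measurableSet_Ioi (ae_of_all _ h2)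
    _ ≤ ENNReal.ofReal 2 * ∫⁻ t, (Set.Ioo 0 A).indicator (fun _ => K) t := by
        gcongr; exact Measure.restrict_le_self
    _ = _ := by
        rw [lintegral_indicator measurableSet_Ioo, setLIntegral_const, Real.volume_Ioo]
        simp; ring

/-! ### Weak type (1,1) of the positive Bergman operator -/

/-- The integral operator whose kernel is the modulus `1 / |1 - ⟨z, w⟩| ^ (n + 1)`. -/
noncomputable def bergmanPositive {n : ℕ} (f : Cn n → ℝ≥0∞) (z : Cn n) : ℝ≥0∞ :=
  ∫⁻ w, (ENNReal.ofReal (hermGauge z w ^ (n + 1)))⁻¹ * f w ∂(ballVolume n)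

/-- With `d` the gauge of `z` and `w`, a set of vertices `x` of volume of order `d^{n+1}` and defect
of order `d` has tents containing both points. There the product of the two kernels is at least of
order `d^{-2(n+1)}`. -/
theorem exists_inv_hermGauge_pow_le (n : ℕ) [NeZero n] : ∃ C : NNReal, 0 < C ∧
    ∀ z w : Cn n, ‖z‖ < 1 → ‖w‖ < 1 →
      (ENNReal.ofReal (hermGauge z w ^ (n + 1)))⁻¹ ≤
        C * ∫⁻ x, tentKernel x z * tentKernel x w ∂(ballVolume n) := by
  classical
  obtain ⟨c, hc, hvol⟩ := exists_le_volume_interior_region n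
  obtain ⟨K, hK⟩ : ∃ K : ℝ, K = 2 ^ (n + 1) * (3 / 2) ^ (2 * (n + 1)) / c := ⟨_, rfl⟩
  have hK0 : 0 < K := by rw [hK]; positivity
  refine ⟨K.toNNReal, by positivity, fun z w hz hw => ?_⟩
  obtain ⟨d, hd⟩ : ∃ d, d = hermGauge z w := ⟨_, rfl⟩
  have hd0 : 0 < d := hd ▸ hermGauge_pos hz hw
  have hd2 : d ≤ 2 := hd ▸ hermGauge_le_two hz hw
  have hzd := one_sub_sq_le_two_mul_hermGauge hz hw
  rw [← hd] at hzd ⊢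
  -- The scale `δ = d / 2` meets both requirements: `1 - ‖z‖² ≤ 2 d = 4 δ`, and `d ≤ 2` gives `δ ≤
  -- 1`.
  have hE := hvol z (d / 2) hz (by linarith) (by linarith)
  set E := {x : Cn n | hermGauge x z ≤ 6 * (d / 2) ∧ d / 2 ≤ 4 * (1 - ‖x‖ ^ 2) ∧
    1 - ‖x‖ ^ 2 ≤ 3 * (d / 2)} with hEdef
  have hEm : MeasurableSet E := by
    have h1 : Continuous fun x : Cn n => hermGauge x z := by unfold hermGauge; fun_prop
    have h2 : Continuous fun x : Cn n => 4 * (1 - ‖x‖ ^ 2) := by fun_prop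
    have h3 : Continuous fun x : Cn n => 1 - ‖x‖ ^ 2 := by fun_prop
    exact ((isClosed_le h1 continuous_const).inter ((isClosed_le continuous_const h2).inter
      (isClosed_le h3 continuous_const))).measurableSet
  have hlow : ∀ x ∈ E, (ENNReal.ofReal ((3 * (d / 2)) ^ (2 * (n + 1))))⁻¹ ≤
      tentKernel x z * tentKernel x w := by
    rintro x ⟨h1, h2, h3⟩
    have hs : 0 < 1 - ‖x‖ ^ 2 := by linarith
    have hx : ‖x‖ < 1 := by nlinarith [norm_nonneg x]
    have hxz : z ∈ tent x := by
      change hermGauge x z < 100 * (1 - ‖x‖ ^ 2)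
      linarith
    -- The aperture 100 suffices: the gauge is at most `3 (3 d + d) = 12 d`, while the defect of `x`
    -- is at least `d / 8`.
    have hxw : w ∈ tent x := by
      have := hermGauge_triangle hx hz hw
      change hermGauge x w < 100 * (1 - ‖x‖ ^ 2)
      linarith
    simp only [tentKernel, hxz, hxw, if_true]
    rw [← ENNReal.mul_inv (Or.inr ENNReal.ofReal_ne_top) (Or.inl ENNReal.ofReal_ne_top),
      ← ENNReal.ofReal_mul (by positivity), ENNReal.inv_le_inv, ← pow_add, ← two_mul]
    exact ENNReal.ofReal_le_ofReal (pow_le_pow_left₀ hs.le h3 _)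
  calc (ENNReal.ofReal (d ^ (n + 1)))⁻¹
      = ENNReal.ofReal K * ((ENNReal.ofReal ((3 * (d / 2)) ^ (2 * (n + 1))))⁻¹ *
          ENNReal.ofReal (c * (d / 2) ^ (n + 1))) := by
        rw [← ENNReal.ofReal_inv_of_pos (by positivity), ← ENNReal.ofReal_inv_of_pos (by positivity),
          ← ENNReal.ofReal_mul (by positivity), ← ENNReal.ofReal_mul hK0.le, hK]
        congr 1
        have : 3 * (d / 2) = 3 / 2 * d := by ring
        rw [this, mul_pow, div_pow d, show d ^ (2 * (n + 1)) = (d ^ (n + 1)) ^ 2 by ring]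
        field_simp
    _ ≤ ENNReal.ofReal K * ((ENNReal.ofReal ((3 * (d / 2)) ^ (2 * (n + 1))))⁻¹ *
          ballVolume n E) := by gcongr
    _ ≤ ENNReal.ofReal K * ∫⁻ x, tentKernel x z * tentKernel x w ∂(ballVolume n) := by
        refine mul_le_mul_right ?_ _
        rw [← setLIntegral_const]
        exact (setLIntegral_mono_ae' hEm (ae_of_all _ hlow)).trans (setLIntegral_le_lintegral _ _)

theorem exists_bergmanPositive_le (n : ℕ) [NeZero n] : ∃ C : NNReal, 0 < C ∧
    ∀ f : Cn n → ℝ≥0∞, Measurable f → ∀ z : Cn n, ‖z‖ < 1 →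
      bergmanPositive f z ≤ C * tentAdjoint (tentAverage f) z := by
  obtain ⟨C, hC, hk⟩ := exists_inv_hermGauge_pow_le n
  refine ⟨C, hC, fun f hf z hz => ?_⟩
  have hm := measurable_tentKernel n
  have hm1 : ∀ y : Cn n, Measurable fun x : Cn n => tentKernel x y := fun y =>
    hm.of_uncurry_right
  have hm2 : Measurable fun w => ∫⁻ x, tentKernel x z * tentKernel x w ∂(ballVolume n) :=
    Measurable.lintegral_prod_left' (f := fun p : Cn n × Cn n => tentKernel p.1 z *
      Function.uncurry tentKernel p) (((hm1 z).comp measurable_fst).mul hm)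
  calc bergmanPositive f z
      ≤ ∫⁻ w, C * ((∫⁻ x, tentKernel x z * tentKernel x w ∂(ballVolume n)) * f w)
          ∂(ballVolume n) := by
        refine lintegral_mono_ae ?_
        filter_upwards [ae_norm_lt_one n] with w hw
        rw [← mul_assoc]
        gcongr
        exact hk z w hz hw
    _ = C * ∫⁻ w, (∫⁻ x, tentKernel x z * tentKernel x w ∂(ballVolume n)) * f w
          ∂(ballVolume n) := lintegral_const_mul _ (hm2.mul hf)
    _ = C * ∫⁻ w, tentAdjoint (fun x => tentKernel x z) w * f w ∂(ballVolume n) := by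
        unfold tentAdjoint
        simp_rw [mul_comm (tentKernel _ z)]
    _ = C * tentAdjoint (tentAverage f) z := by
        rw [← lintegral_mul_tentAverage hf (hm1 z), tentAdjoint]

theorem volume_tentAverage_gt_le {n : ℕ} {C : NNReal}
    (hV : ∀ (f : Cn n → ℝ≥0∞) (t : ℝ≥0∞),
      t * ballVolume n (⋃ x ∈ {x : Cn n | ‖x‖ < 1 ∧ t < tentAverage f x}, tent x) ≤
        C * ∫⁻ w, f w ∂(ballVolume n)) (f : Cn n → ℝ≥0∞) (t : ℝ≥0∞) :
    t * ballVolume n {x | t < tentAverage f x} ≤ C * ∫⁻ w, f w ∂(ballVolume n) := by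
  refine le_trans (mul_le_mul_right (measure_mono_ae ?_) _) (hV f t)
  filter_upwards [ae_norm_lt_one n] with x hx hxt
  refine Set.mem_iUnion₂.2 ⟨x, ⟨hx, hxt⟩, ?_⟩
  change hermGauge x x < _
  rw [hermGauge_self hx]
  nlinarith [norm_nonneg x]

theorem exists_tentAverage_one_le (n : ℕ) [NeZero n] : ∃ M : ℝ, 0 < M ∧
    ∀ x : Cn n, ‖x‖ < 1 → tentAverage (fun _ => 1) x ≤ ENNReal.ofReal M := by
  obtain ⟨C, hC, hvol⟩ := exists_volume_hermGauge_ball_le n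
  refine ⟨C * 100 ^ (n + 1), by positivity, fun x hx => ?_⟩
  have hs : 0 < 1 - ‖x‖ ^ 2 := by nlinarith [norm_nonneg x]
  rw [tentAverage_eq _ hx, setLIntegral_one]
  refine (mul_le_mul_right (hvol x _ hx (by linarith)) _).trans_eq ?_
  rw [← ENNReal.ofReal_inv_of_pos (by positivity), ← ENNReal.ofReal_mul (by positivity), mul_pow]
  congr 1
  field_simp

/-- The adjoint at `z` sees only vertices whose tent contains `z`. Outside the union all of these
have average at most `t`, so the truncation changes nothing. -/
theorem tentAdjoint_congr {n : ℕ} {t : ℝ≥0∞} {f : Cn n → ℝ≥0∞} {z : Cn n}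
    (hz : z ∉ ⋃ x ∈ {x : Cn n | ‖x‖ < 1 ∧ t < tentAverage f x}, tent x) :
    tentAdjoint (tentAverage f) z =
      tentAdjoint ({x | tentAverage f x ≤ t}.indicator (tentAverage f)) z := by
  refine lintegral_congr_ae ?_
  filter_upwards [ae_norm_lt_one n] with x hx
  by_cases hxt : tentAverage f x ≤ t
  · rw [Set.indicator_of_mem (s := {x | tentAverage f x ≤ t}) hxt]
  · have : z ∉ tent x := fun h => hz (Set.mem_iUnion₂.2 ⟨x, ⟨hx, not_le.1 hxt⟩, h⟩)
    simp [tentKernel, this]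

/-- Comparing `a` with `ε b` proves this form of Young's inequality even for infinite values. It
replaces Cauchy–Schwarz, and `ε` is free for absorption. -/
theorem ENNReal.mul_le_add_of_pos {ε : ℝ} (hε : 0 < ε) (a b : ℝ≥0∞) :
    a * b ≤ ENNReal.ofReal ε⁻¹ * a ^ 2 + ENNReal.ofReal ε * b ^ 2 := by
  have h1 : ENNReal.ofReal ε⁻¹ * ENNReal.ofReal ε = 1 := by
    rw [← ENNReal.ofReal_mul (by positivity), inv_mul_cancel₀ hε.ne', ENNReal.ofReal_one]
  rcases le_total a (ENNReal.ofReal ε * b) with h | h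
  · refine le_trans ?_ le_add_self
    calc a * b ≤ ENNReal.ofReal ε * b * b := by gcongr
      _ = _ := by ring
  · refine le_trans ?_ le_self_add
    calc a * b = ENNReal.ofReal ε⁻¹ * (a * (ENNReal.ofReal ε * b)) := by
          rw [← one_mul (a * b), ← h1]; ring
      _ ≤ ENNReal.ofReal ε⁻¹ * (a * a) := by gcongr
      _ = _ := by ring

theorem exists_weakType_bergmanPositive (n : ℕ) [NeZero n] : ∃ C : NNReal, 0 < C ∧
    ∀ f : Cn n → ℝ≥0∞, Measurable f → ∀ t : ℝ, 0 < t →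
      ENNReal.ofReal t * ballVolume n {z | ENNReal.ofReal t < bergmanPositive f z} ≤
        C * ∫⁻ w, f w ∂(ballVolume n) := by
  obtain ⟨C₀, hC₀, hdom⟩ := exists_bergmanPositive_le n
  obtain ⟨C, hC, hV⟩ := exists_volume_iUnion_tent_le n
  obtain ⟨M, hM, hone⟩ := exists_tentAverage_one_le n
  have hweak := volume_tentAverage_gt_le hV
  have hfin : IsFiniteMeasure (ballVolume n) :=
    ⟨by rw [Measure.restrict_apply_univ]; exact measure_ball_lt_top⟩
  -- the same estimate for the averages followed by their adjoint
  have key : ∀ f : Cn n → ℝ≥0∞, Measurable f → ∀ t : ℝ, 0 < t →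
      ENNReal.ofReal t * ballVolume n {z | ENNReal.ofReal t < tentAdjoint (tentAverage f) z} ≤
        (C + 16 * M.toNNReal * C * C : NNReal) * ∫⁻ w, f w ∂(ballVolume n) := by
    intro f hf t ht
    set Ω := ⋃ x ∈ {x : Cn n | ‖x‖ < 1 ∧ ENNReal.ofReal t < tentAverage f x}, tent x with hΩ
    set h := {x | tentAverage f x ≤ ENNReal.ofReal t}.indicator (tentAverage f) with hh
    have hNf := measurable_tentAverage hf
    have hhm : Measurable h := hNf.indicator (measurableSet_le hNf measurable_const)
    set G := {z | ENNReal.ofReal t < tentAdjoint h z} with hG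
    have hGm : MeasurableSet G := measurableSet_lt measurable_const (measurable_tentAdjoint hhm)
    set g := tentAverage (G.indicator (fun _ => (1 : ℝ≥0∞))) with hg
    have h1m : Measurable (G.indicator (fun _ => (1 : ℝ≥0∞))) := measurable_const.indicator hGm
    have hgm : Measurable g := measurable_tentAverage h1m
    have hh2 : ∫⁻ x, h x ^ 2 ∂(ballVolume n) ≤
        2 * ENNReal.ofReal t * (C * ∫⁻ w, f w ∂(ballVolume n)) :=
      lintegral_sq_truncate_le hNf (fun s _ => hweak f _) ht.le
    have hgM : ∀ᵐ x ∂(ballVolume n), g x ≤ ENNReal.ofReal M := by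
      filter_upwards [ae_norm_lt_one n] with x hx
      refine le_trans (lintegral_mono fun w => ?_) (hone x hx)
      exact mul_le_mul_right (Set.indicator_le_self' (fun _ _ => zero_le_one) w) _
    -- Since `g ≤ M` almost everywhere, truncation at height `M` loses nothing and the weak bound
    -- becomes an `L²` bound by the volume of `G`.
    have hg2 : ∫⁻ x, g x ^ 2 ∂(ballVolume n) ≤
        2 * ENNReal.ofReal M * (C * ballVolume n G) := by
      have h1 := lintegral_sq_truncate_le hgm
        (fun s _ => hweak (G.indicator fun _ => (1 : ℝ≥0∞)) (ENNReal.ofReal s)) hM.le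
      rw [lintegral_indicator hGm, setLIntegral_one] at h1
      refine le_trans (lintegral_mono_ae ?_) h1
      filter_upwards [hgM] with x hx
      rw [Set.indicator_of_mem (s := {x | g x ≤ ENNReal.ofReal M}) hx]
    -- Chebyshev on `G`, then duality moves the adjoint onto the indicator of `G`.
    have hGle : ENNReal.ofReal t * ballVolume n G ≤ ∫⁻ x, h x * g x ∂(ballVolume n) := by
      rw [hg, lintegral_mul_tentAverage h1m hhm, ← setLIntegral_const]
      rw [← lintegral_indicator hGm]
      refine lintegral_mono fun z => ?_
      by_cases hz : z ∈ G
      · simpa [hz] using (show ENNReal.ofReal t < tentAdjoint h z from hz).le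
      · simp [hz]
    -- This choice makes the second term of `hAB` equal to `t |G| / 2`, which is absorbed on the
    -- left because `|G|` is finite.
    set ε : ℝ := t / (4 * M * C) with hε
    have hC' : (0 : ℝ) < C := hC
    have hε0 : 0 < ε := by positivity
    have hAB : ∫⁻ x, h x * g x ∂(ballVolume n) ≤
        ENNReal.ofReal ε⁻¹ * (2 * ENNReal.ofReal t * (C * ∫⁻ w, f w ∂(ballVolume n))) +
        ENNReal.ofReal ε * (2 * ENNReal.ofReal M * (C * ballVolume n G)) := by
      calc _ ≤ ∫⁻ x, ENNReal.ofReal ε⁻¹ * h x ^ 2 + ENNReal.ofReal ε * g x ^ 2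
            ∂(ballVolume n) := lintegral_mono fun x => ENNReal.mul_le_add_of_pos hε0 _ _
        _ = ENNReal.ofReal ε⁻¹ * ∫⁻ x, h x ^ 2 ∂(ballVolume n) +
            ENNReal.ofReal ε * ∫⁻ x, g x ^ 2 ∂(ballVolume n) := by
          rw [lintegral_add_left ((hhm.pow_const 2).const_mul _),
            lintegral_const_mul _ (hhm.pow_const 2), lintegral_const_mul _ (hgm.pow_const 2)]
        _ ≤ _ := by gcongr
    have hGfinal : ENNReal.ofReal t * ballVolume n G ≤
        (16 * M.toNNReal * C * C : NNReal) * ∫⁻ w, f w ∂(ballVolume n) := by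
      by_cases hI : ∫⁻ w, f w ∂(ballVolume n) = ⊤
      · rw [hI, ENNReal.mul_top]
        · exact le_top
        · have : 0 < M.toNNReal := Real.toNNReal_pos.2 hM
          exact_mod_cast (by positivity : 0 < 16 * M.toNNReal * C * C).ne'
      have hle := hGle.trans hAB
      obtain ⟨I, hI'⟩ := WithTop.ne_top_iff_exists.1 hI
      obtain ⟨m, hm⟩ := WithTop.ne_top_iff_exists.1 (measure_ne_top (ballVolume n) G)
      change (I : ℝ≥0∞) = _ at hI'
      change (m : ℝ≥0∞) = _ at hm
      rw [← hI', ← hm] at hle ⊢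
      simp only [ENNReal.ofReal] at hle ⊢
      norm_cast at hle ⊢
      rw [← NNReal.coe_le_coe] at hle ⊢
      push_cast at hle ⊢
      rw [Real.coe_toNNReal _ ht.le, Real.coe_toNNReal _ hM.le, Real.coe_toNNReal _ hε0.le,
        Real.coe_toNNReal _ (inv_nonneg.2 hε0.le)] at hle
      rw [Real.coe_toNNReal _ ht.le, Real.coe_toNNReal _ hM.le]
      have e1 : ε⁻¹ * (2 * t * (C * I)) = 8 * M * C * C * I := by
        rw [hε]; field_simp; ring
      have e2 : ε * (2 * M * (C * m)) = t * m / 2 := by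
        rw [hε]; field_simp; ring
      rw [e1, e2] at hle
      linarith
    have hsub : {z | ENNReal.ofReal t < tentAdjoint (tentAverage f) z} ⊆ Ω ∪ G := by
      intro z hz
      by_cases hzΩ : z ∈ Ω
      · exact Or.inl hzΩ
      · refine Or.inr ?_
        have hz' : ENNReal.ofReal t < tentAdjoint (tentAverage f) z := hz
        rwa [tentAdjoint_congr hzΩ] at hz'
    calc _ ≤ ENNReal.ofReal t * (ballVolume n Ω + ballVolume n G) :=
          mul_le_mul_right ((measure_mono hsub).trans (measure_union_le _ _)) _
      _ ≤ C * ∫⁻ w, f w ∂(ballVolume n) +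
          (16 * M.toNNReal * C * C : NNReal) * ∫⁻ w, f w ∂(ballVolume n) := by
        rw [mul_add]
        exact add_le_add (hV f _) hGfinal
      _ = _ := by rw [ENNReal.coe_add, add_mul]
  refine ⟨C₀ * (C + 16 * M.toNNReal * C * C), by positivity, fun f hf t ht => ?_⟩
  have hC₀' : (0 : ℝ) < C₀ := hC₀
  have hct : ENNReal.ofReal t = C₀ * ENNReal.ofReal (t / C₀) := by
    rw [← ENNReal.ofReal_coe_nnreal, ← ENNReal.ofReal_mul hC₀'.le]
    congr 1
    field_simp
  have hsub : ballVolume n {z | ENNReal.ofReal t < bergmanPositive f z} ≤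
      ballVolume n {z | ENNReal.ofReal (t / C₀) < tentAdjoint (tentAverage f) z} := by
    refine measure_mono_ae ?_
    filter_upwards [ae_norm_lt_one n] with z hz hzt
    have h1 : ENNReal.ofReal t < _ := lt_of_lt_of_le hzt (hdom f hf z hz)
    rw [hct] at h1
    exact lt_of_mul_lt_mul_left' h1
  rw [ENNReal.coe_mul, mul_assoc]
  calc _ ≤ ENNReal.ofReal t * ballVolume n
        {z | ENNReal.ofReal (t / C₀) < tentAdjoint (tentAverage f) z} := mul_le_mul_right hsub _
    _ ≤ _ := by
      rw [hct, mul_assoc]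
      exact mul_le_mul_right (key f hf _ (by positivity)) _

/-! ### The mean value property and the reproducing formula -/

theorem measurePreserving_smul_of_norm_eq_one {n : ℕ} {c : ℂ} (hc : ‖c‖ = 1) :
    MeasurePreserving (fun w : Cn n => c • w) (volume : Measure (Cn n)) volume :=
  measurePreserving_unitary
    ⟨LinearEquiv.smulOfNeZero ℂ (Cn n) c (norm_pos_iff.1 (hc ▸ one_pos)), fun w => by
      simp [norm_smul, hc]⟩

theorem integral_circle_eq {n : ℕ} {r : ℝ} {H : Cn n → ℂ}
    (hH : DifferentiableOn ℂ H (ball 0 r)) {w : Cn n} (hw : w ∈ ball (0 : Cn n) r) :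
    ∫ θ in Set.Ioc 0 (2 * Real.pi), H (circleMap 0 1 θ • w) = (2 * Real.pi) • H 0 := by
  rw [mem_ball_zero_iff] at hw
  have hmaps : ∀ ζ ∈ closedBall (0 : ℂ) 1, ζ • w ∈ ball (0 : Cn n) r := fun ζ hζ => by
    rw [mem_closedBall_zero_iff] at hζ
    rw [mem_ball_zero_iff, norm_smul]
    nlinarith [norm_nonneg w, norm_nonneg ζ]
  have hd : DifferentiableOn ℂ (fun ζ : ℂ => H (ζ • w)) (closedBall 0 1) :=
    hH.comp (by fun_prop) hmaps
  have h := DiffContOnCl.circleAverage (f := fun ζ : ℂ => H (ζ • w)) (c := 0) (R := 1)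
    (by rw [abs_one]
        exact ⟨hd.mono ball_subset_closedBall, by
          rw [closure_ball _ one_ne_zero]; exact hd.continuousOn⟩)
  rw [Real.circleAverage_def, intervalIntegral.integral_of_le Real.two_pi_pos.le, zero_smul] at h
  rw [← h, smul_smul, mul_inv_cancel₀ Real.two_pi_pos.ne', one_smul]

/-- The integral is unchanged under `w ↦ e^{iθ} w`. Averaging over `θ` and exchanging integrals
reduces to the one-variable mean value property of `ζ ↦ H (ζ w)`. -/
theorem integral_ball_zero_of_differentiableOn {n : ℕ} {r : ℝ} {H : Cn n → ℂ}
    (hH : DifferentiableOn ℂ H (ball 0 r)) (hi : IntegrableOn H (ball 0 r)) :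
    ∫ w in ball (0 : Cn n) r, H w = volume.real (ball (0 : Cn n) r) • H 0 := by
  set μ : Measure (Cn n) := volume.restrict (ball 0 r) with hμ
  set ν : Measure ℝ := volume.restrict (Set.Ioc 0 (2 * Real.pi)) with hν
  have hmp : ∀ θ : ℝ, MeasurePreserving (fun w : Cn n => circleMap 0 1 θ • w) μ μ := by
    intro θ
    have h := (measurePreserving_smul_of_norm_eq_one (n := n) (c := circleMap 0 1 θ)
      (by simp)).restrict_preimage (s := ball 0 r) measurableSet_ball
    have : (fun w : Cn n => circleMap 0 1 θ • w) ⁻¹' ball 0 r = ball 0 r := by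
      ext w; simp [norm_smul]
    rwa [this] at h
  have : IsFiniteMeasure μ := ⟨by rw [hμ, Measure.restrict_apply_univ]; exact measure_ball_lt_top⟩
  -- Rotation as a measure-preserving skew product supplies the joint integrability that Fubini
  -- requires.
  have hskew : MeasurePreserving (fun p : ℝ × Cn n => (p.1, circleMap 0 1 p.1 • p.2))
      (ν.prod μ) (ν.prod μ) :=
    (MeasurePreserving.id ν).skew_product (g := fun θ w => circleMap 0 1 θ • w)
      (by fun_prop) (ae_of_all _ fun θ => (hmp θ).map_eq)
  have hint : Integrable (fun p : ℝ × Cn n => H (circleMap 0 1 p.1 • p.2)) (ν.prod μ) :=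
    hskew.integrable_comp_of_integrable (g := fun p : ℝ × Cn n => H p.2) (hi.comp_snd ν)
  have hswap := integral_integral_swap (f := fun (θ : ℝ) (w : Cn n) => H (circleMap 0 1 θ • w)) hint
  have h1 : ∀ θ : ℝ, ∫ w, H (circleMap 0 1 θ • w) ∂μ = ∫ w, H w ∂μ := fun θ => by
    have hne : circleMap 0 1 θ ≠ 0 := circleMap_ne_center one_ne_zero
    exact (hmp θ).integral_comp (Homeomorph.smulOfNeZero _ hne).measurableEmbedding H
  have h2 : ∫ w, ∫ θ, H (circleMap 0 1 θ • w) ∂ν ∂μ = ∫ _, (2 * Real.pi) • H 0 ∂μ :=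
    setIntegral_congr_fun measurableSet_ball fun w hw => integral_circle_eq hH hw
  simp_rw [h1] at hswap
  rw [h2, integral_const, integral_const, hν, hμ, measureReal_restrict_apply_univ,
    measureReal_restrict_apply_univ, Real.volume_real_Ioc_of_le Real.two_pi_pos.le, sub_zero,
    smul_comm] at hswap
  exact smul_right_injective _ Real.two_pi_pos.ne' hswap

/-- The mean value property over balls. -/
theorem integral_ball_of_differentiableOn {n : ℕ} {a : Cn n} {r : ℝ} {H : Cn n → ℂ}
    (hH : DifferentiableOn ℂ H (ball a r)) (hi : IntegrableOn H (ball a r)) :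
    ∫ w in ball a r, H w = volume.real (ball a r) • H a := by
  have hpre : (fun w => a + w) ⁻¹' ball a r = ball 0 r := by simp
  have hmp : MeasurePreserving (fun w : Cn n => a + w) volume volume := measurePreserving_add_left _ a
  have hme : MeasurableEmbedding (fun w : Cn n => a + w) := measurableEmbedding_addLeft a
  rw [← hmp.setIntegral_preimage_emb hme, hpre, ← hmp.measureReal_preimage
    measurableSet_ball.nullMeasurableSet, hpre]
  have h := integral_ball_zero_of_differentiableOn (H := fun w => H (a + w)) (r := r)
    (hH.comp (by fun_prop) fun w hw => by simpa using hw)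
    (by rw [← hpre]; exact (hmp.integrableOn_comp_preimage hme).2 hi)
  simpa using h

/-- The normalising constant `n! / πⁿ` of the Bergman kernel is the reciprocal of this volume. -/
theorem volume_real_unitBall (n : ℕ) [NeZero n] :
    volume.real (unitBall n) = Real.pi ^ n / (n ! : ℝ) := by
  have hf : Module.finrank ℝ (Cn n) = 2 * n := by
    rw [← Module.finrank_mul_finrank ℝ ℂ (Cn n)]; simp
  rw [Measure.real, InnerProductSpace.volume_ball, hf, ENNReal.ofReal_one, one_pow, one_mul,
    pow_mul, Real.sq_sqrt Real.pi_pos.le]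
  have : ((2 * n : ℕ) : ℝ) / 2 + 1 = n + 1 := by push_cast; ring
  rw [this, Real.Gamma_nat_eq_factorial, ENNReal.toReal_ofReal (by positivity)]

/-! ### Involutive automorphisms of the ball and their Jacobians. -/

/-- The linear part of `ballInvolution`: the identity on the first coordinate and
 `√(1 - ρ²)` on the others. -/
noncomputable def axisScaling (n : ℕ) [NeZero n] (ρ : ℝ) : Cn n →L[ℂ] Cn n :=
  LinearMap.toContinuousLinearMap
    { toFun := fun w => WithLp.toLp 2 fun i => (if i = 0 then 1 else (√(1 - ρ ^ 2) : ℂ)) * w i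
      map_add' := fun v w => by ext i; simp [mul_add]
      map_smul' := fun c w => by ext i; simp [mul_left_comm] }

theorem axisScaling_apply {n : ℕ} [NeZero n] (ρ : ℝ) (w : Cn n) (i : Fin n) :
    axisScaling n ρ w i = (if i = 0 then 1 else (√(1 - ρ ^ 2) : ℂ)) * w i := rfl

/-- The involutive automorphism of the ball that exchanges `0` and `ρ e₀`. -/
noncomputable def ballInvolution {n : ℕ} [NeZero n] (ρ : ℝ) (w : Cn n) : Cn n :=
  (1 - (ρ : ℂ) * w 0)⁻¹ • (EuclideanSpace.single 0 (ρ : ℂ) - axisScaling n ρ w)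

/-- The derivative of `ballInvolution`. -/
noncomputable def ballInvolutionDeriv {n : ℕ} [NeZero n] (ρ : ℝ) (w : Cn n) : Cn n →L[ℂ] Cn n :=
  (1 - (ρ : ℂ) * w 0)⁻¹ • (-axisScaling n ρ) +
    (((ρ : ℂ) * (1 - (ρ : ℂ) * w 0)⁻¹ ^ 2) • (EuclideanSpace.proj 0 : Cn n →L[ℂ] ℂ)).smulRight
      (EuclideanSpace.single 0 (ρ : ℂ) - axisScaling n ρ w)

section involution

variable {n : ℕ} [NeZero n] {ρ : ℝ} {w : Cn n}

theorem one_sub_mul_coord_ne_zero (h0 : 0 ≤ ρ) (h1 : ρ < 1) (hw : ‖w‖ < 1) :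
    1 - (ρ : ℂ) * w 0 ≠ 0 := by
  intro h
  have h2 : ‖(ρ : ℂ) * w 0‖ = 1 := by rw [← sub_eq_zero.1 h, norm_one]
  rw [norm_mul, Complex.norm_real, Real.norm_of_nonneg h0] at h2
  have h3 := PiLp.norm_apply_le w 0
  nlinarith [norm_nonneg (w 0)]

theorem sqrt_one_sub_sq_complex (h0 : 0 ≤ ρ) (h1 : ρ < 1) :
    (√(1 - ρ ^ 2) : ℂ) ^ 2 = 1 - (ρ : ℂ) ^ 2 := by
  rw [← Complex.ofReal_pow, Real.sq_sqrt (by nlinarith)]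
  push_cast
  rfl

theorem one_sub_sq_complex_ne_zero (h0 : 0 ≤ ρ) (h1 : ρ < 1) : 1 - (ρ : ℂ) ^ 2 ≠ 0 := by
  have : (1 - ρ ^ 2 : ℝ) ≠ 0 := by nlinarith
  exact_mod_cast this

theorem ballInvolution_apply_zero :
    ballInvolution ρ w 0 = (1 - (ρ : ℂ) * w 0)⁻¹ * (ρ - w 0) := by
  simp [ballInvolution, axisScaling_apply]

theorem ballInvolution_apply_of_ne {i : Fin n} (hi : i ≠ 0) :
    ballInvolution ρ w i = (1 - (ρ : ℂ) * w 0)⁻¹ * (-(√(1 - ρ ^ 2) * w i)) := by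
  simp [ballInvolution, axisScaling_apply, hi]

theorem one_sub_mul_ballInvolution (h0 : 0 ≤ ρ) (h1 : ρ < 1) (hw : ‖w‖ < 1) :
    1 - (ρ : ℂ) * ballInvolution ρ w 0 = (1 - (ρ : ℂ) ^ 2) * (1 - (ρ : ℂ) * w 0)⁻¹ := by
  have := one_sub_mul_coord_ne_zero h0 h1 hw
  rw [ballInvolution_apply_zero]
  field_simp
  ring

theorem ballInvolution_involutive (h0 : 0 ≤ ρ) (h1 : ρ < 1) (hw : ‖w‖ < 1) :
    ballInvolution ρ (ballInvolution ρ w) = w := by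
  have ha := one_sub_mul_coord_ne_zero h0 h1 hw
  have hs := one_sub_sq_complex_ne_zero h0 h1
  ext i
  by_cases hi : i = 0
  · subst hi
    rw [ballInvolution_apply_zero, one_sub_mul_ballInvolution h0 h1 hw, ballInvolution_apply_zero]
    field_simp
    ring
  · rw [ballInvolution_apply_of_ne hi, one_sub_mul_ballInvolution h0 h1 hw,
      ballInvolution_apply_of_ne hi]
    have hq := sqrt_one_sub_sq_complex h0 h1
    field_simp
    rw [hq]

/-- The classical identity for `1 - |φ(w)|²`, cleared of denominators. Positivity of its right side
shows that the ball is preserved. -/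
theorem norm_sq_ballInvolution (h0 : 0 ≤ ρ) (h1 : ρ < 1) (hw : ‖w‖ < 1) :
    ‖1 - (ρ : ℂ) * w 0‖ ^ 2 * (1 - ‖ballInvolution ρ w‖ ^ 2) = (1 - ρ ^ 2) * (1 - ‖w‖ ^ 2) := by
  have ha := one_sub_mul_coord_ne_zero h0 h1 hw
  have hmul : ‖1 - (ρ : ℂ) * w 0‖ ^ 2 * ‖ballInvolution ρ w‖ ^ 2 =
      ‖EuclideanSpace.single 0 (ρ : ℂ) - axisScaling n ρ w‖ ^ 2 := by
    rw [ballInvolution, norm_smul, norm_inv]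
    have := norm_ne_zero_iff.2 ha
    field_simp
  have h2 : ‖EuclideanSpace.single 0 (ρ : ℂ) - axisScaling n ρ w‖ ^ 2 =
      ‖(ρ : ℂ) - w 0‖ ^ 2 + (1 - ρ ^ 2) * (‖w‖ ^ 2 - ‖w 0‖ ^ 2) := by
    rw [EuclideanSpace.norm_sq_eq, EuclideanSpace.norm_sq_eq w,
      ← Finset.add_sum_erase _ _ (Finset.mem_univ 0),
      ← Finset.add_sum_erase _ (fun i => ‖w i‖ ^ 2) (Finset.mem_univ 0), add_sub_cancel_left,
      Finset.mul_sum]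
    congr 1
    · simp [axisScaling_apply]
    · refine Finset.sum_congr rfl fun i hi => ?_
      have hi' := Finset.ne_of_mem_erase hi
      simp only [PiLp.sub_apply, PiLp.single_apply, axisScaling_apply, hi', if_false, zero_sub,
        norm_neg, norm_mul, Complex.norm_real, mul_pow, Real.norm_eq_abs, sq_abs]
      rw [Real.sq_sqrt (by nlinarith)]
  have h3 : ‖1 - (ρ : ℂ) * w 0‖ ^ 2 - ‖(ρ : ℂ) - w 0‖ ^ 2 = (1 - ρ ^ 2) * (1 - ‖w 0‖ ^ 2) := by
    rw [← Complex.normSq_eq_norm_sq, ← Complex.normSq_eq_norm_sq, ← Complex.normSq_eq_norm_sq]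
    simp [Complex.normSq_apply]
    ring
  rw [mul_sub, hmul, h2]
  linarith

theorem ballInvolution_mem (h0 : 0 ≤ ρ) (h1 : ρ < 1) (hw : w ∈ unitBall n) :
    ballInvolution ρ w ∈ unitBall n := by
  rw [mem_ball_zero_iff] at hw ⊢
  have h := norm_sq_ballInvolution h0 h1 hw
  have ha := norm_pos_iff.2 (one_sub_mul_coord_ne_zero h0 h1 hw)
  have h2 : 0 < (1 - ρ ^ 2) * (1 - ‖w‖ ^ 2) :=
    mul_pos (by nlinarith) (by nlinarith [norm_nonneg w])
  rw [← h] at h2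
  have h3 := pos_of_mul_pos_right h2 (by positivity)
  nlinarith [norm_nonneg (ballInvolution ρ w)]

theorem ballInvolution_image (h0 : 0 ≤ ρ) (h1 : ρ < 1) :
    ballInvolution ρ '' unitBall n = unitBall n := by
  ext w
  constructor
  · rintro ⟨v, hv, rfl⟩
    exact ballInvolution_mem h0 h1 hv
  · exact fun hw => ⟨_, ballInvolution_mem h0 h1 hw,
      ballInvolution_involutive h0 h1 (by simpa using hw)⟩

theorem ballInvolution_injOn (h0 : 0 ≤ ρ) (h1 : ρ < 1) :
    Set.InjOn (ballInvolution ρ) (unitBall n) := by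
  intro v hv w hw h
  rw [← ballInvolution_involutive h0 h1 (w := v) (by simpa using hv), h,
    ballInvolution_involutive h0 h1 (by simpa using hw)]

theorem hasFDerivAt_ballInvolution (h0 : 0 ≤ ρ) (h1 : ρ < 1) (hw : ‖w‖ < 1) :
    HasFDerivAt (ballInvolution ρ) (ballInvolutionDeriv ρ w) w := by
  have ha := one_sub_mul_coord_ne_zero h0 h1 hw
  have hp : HasFDerivAt (fun v : Cn n => v 0) (EuclideanSpace.proj 0 : Cn n →L[ℂ] ℂ) w :=
    (EuclideanSpace.proj 0 : Cn n →L[ℂ] ℂ).hasFDerivAt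
  have h2 := (hasDerivAt_inv ha).comp_hasFDerivAt w ((hp.const_mul (ρ : ℂ)).const_sub 1)
  have h3 := ((axisScaling n ρ).hasFDerivAt (x := w)).const_sub (EuclideanSpace.single 0 (ρ : ℂ))
  have h4 : HasFDerivAt (ballInvolution ρ) _ w := h2.smul h3
  refine h4.congr_fderiv ?_
  ext v i
  simp only [ballInvolutionDeriv, _root_.add_apply, ContinuousLinearMap.smulRight_apply,
    _root_.smul_apply, PiLp.add_apply, PiLp.smul_apply, smul_eq_mul,
    _root_.neg_apply, Function.comp_apply, inv_pow]
  ring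

/-- The rank-one part of the derivative fills only column 0, so the matrix is lower triangular. With
`a = 1 - ρ w₀`, the diagonal is `-(1 - ρ²) / a²` once and `-√(1 - ρ²) / a` in the other `n - 1`
places. -/
theorem det_ballInvolutionDeriv (h0 : 0 ≤ ρ) (h1 : ρ < 1) (hw : ‖w‖ < 1) :
    ‖LinearMap.det (ballInvolutionDeriv ρ w : Cn n →ₗ[ℂ] Cn n)‖ ^ 2 =
      ((1 - ρ ^ 2) / ‖1 - (ρ : ℂ) * w 0‖ ^ 2) ^ (n + 1) := by
  have ha := one_sub_mul_coord_ne_zero h0 h1 hw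
  set a := 1 - (ρ : ℂ) * w 0 with had
  set b := (EuclideanSpace.basisFun (Fin n) ℂ).toBasis with hb
  have hent : ∀ i j, LinearMap.toMatrix b b (ballInvolutionDeriv ρ w : Cn n →ₗ[ℂ] Cn n) i j =
      a⁻¹ * -((if i = 0 then 1 else (√(1 - ρ ^ 2) : ℂ)) * if i = j then 1 else 0) +
        (ρ * a⁻¹ ^ 2 * if 0 = j then 1 else 0) * ((if i = 0 then (ρ : ℂ) else 0) -
          (if i = 0 then 1 else (√(1 - ρ ^ 2) : ℂ)) * w i) := by
    intro i j
    rw [LinearMap.toMatrix_apply]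
    by_cases hj : 0 = j
    · subst hj
      simp [hb, ballInvolutionDeriv, axisScaling_apply, ← had]
    · simp [hb, ballInvolutionDeriv, axisScaling_apply, ← had, hj]
  rw [← LinearMap.det_toMatrix b, Matrix.det_of_isLowerTriangular]
  · rw [← Finset.mul_prod_erase _ _ (Finset.mem_univ 0), Finset.prod_congr rfl
      (g := fun _ => -(a⁻¹ * (√(1 - ρ ^ 2) : ℂ))), Finset.prod_const,
      Finset.card_erase_of_mem (Finset.mem_univ _), Finset.card_univ, Fintype.card_fin, hent]
    · have h00 : a⁻¹ * -((if (0 : Fin n) = 0 then 1 else (√(1 - ρ ^ 2) : ℂ)) *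
          if (0 : Fin n) = 0 then 1 else 0) + (ρ * a⁻¹ ^ 2 * if (0 : Fin n) = 0 then 1 else 0) *
          ((if (0 : Fin n) = 0 then (ρ : ℂ) else 0) -
            (if (0 : Fin n) = 0 then 1 else (√(1 - ρ ^ 2) : ℂ)) * w 0) =
          -(((1 - ρ ^ 2 : ℝ) : ℂ) * a⁻¹ ^ 2) := by
        simp only [if_true]
        field_simp
        rw [had]
        push_cast
        ring
      have hs : 0 ≤ 1 - ρ ^ 2 := by nlinarith
      obtain ⟨m, hm⟩ := Nat.exists_eq_add_one_of_ne_zero (NeZero.ne n)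
      have hm' : n - 1 = m := by omega
      rw [h00, norm_mul, norm_pow, norm_neg, norm_neg, norm_mul, norm_mul, norm_pow, norm_inv,
        Complex.norm_real, Complex.norm_real, Real.norm_of_nonneg hs,
        Real.norm_of_nonneg (Real.sqrt_nonneg _), hm', hm, mul_pow, ← pow_mul, mul_comm m 2, pow_mul,
        mul_pow ‖a‖⁻¹ (√(1 - ρ ^ 2)), Real.sq_sqrt hs]
      ring
    · intro i hi
      have hi' := Finset.ne_of_mem_erase hi
      rw [hent]
      simp [hi', hi'.symm]
  · intro i j hij
    have hij' : i < j := hij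
    rw [hent]
    have h0j : (0 : Fin n) ≠ j := ((Fin.zero_le i).trans_lt hij').ne
    simp [hij'.ne, h0j]

end involution

/-! ### Change of variables and the reproducing formula. -/

theorem isFiniteMeasure_ballVolume (n : ℕ) : IsFiniteMeasure (ballVolume n) :=
  ⟨by rw [Measure.restrict_apply_univ]; exact measure_ball_lt_top⟩

theorem norm_inv_one_sub_inner_pow_le {n : ℕ} {z w : Cn n} (hz : ‖z‖ < 1) (hw : ‖w‖ < 1) (k : ℕ) :
    ‖((1 - inner ℂ w z) ^ k)⁻¹‖ ≤ ((1 - ‖z‖) ^ k)⁻¹ := by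
  rw [norm_inv, norm_pow]
  have := one_sub_norm_le_hermGauge (z := z) hw
  exact inv_anti₀ (pow_pos (by linarith) _) (pow_le_pow_left₀ (by linarith) this _)

theorem continuousOn_inv_one_sub_inner_pow {n : ℕ} {z : Cn n} (hz : ‖z‖ < 1) (k : ℕ) :
    ContinuousOn (fun w : Cn n => ((1 - inner ℂ w z) ^ k)⁻¹) (unitBall n) :=
  ContinuousOn.inv₀ (by fun_prop) fun w hw =>
    pow_ne_zero _ (one_sub_inner_ne_zero hz (by simpa using hw))

theorem integrable_div_one_sub_inner_pow {n : ℕ} {z : Cn n} (hz : ‖z‖ < 1) {f : Cn n → ℂ}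
    (hf : Integrable f (ballVolume n)) (k : ℕ) :
    Integrable (fun w => f w / (1 - inner ℂ w z) ^ k) (ballVolume n) := by
  simp_rw [div_eq_mul_inv]
  refine hf.mul_bdd (c := ((1 - ‖z‖) ^ k)⁻¹)
    ((continuousOn_inv_one_sub_inner_pow hz k).aestronglyMeasurable measurableSet_ball) ?_
  filter_upwards [ae_norm_lt_one n] with w hw
  exact norm_inv_one_sub_inner_pow_le hz hw k

theorem differentiableOn_div_pow {E : Type*} [NormedAddCommGroup E] [NormedSpace ℂ E] {s : Set E}
    {q d : E → ℂ} (hq : DifferentiableOn ℂ q s) (hd : DifferentiableOn ℂ d s)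
    (hne : ∀ w ∈ s, d w ≠ 0) (k : ℕ) : DifferentiableOn ℂ (fun w => q w / d w ^ k) s :=
  fun w hw => by
    simp_rw [div_eq_mul_inv]
    have h := (hasDerivAt_inv (pow_ne_zero k (hne w hw))).differentiableAt.comp_differentiableWithinAt
      w ((hd w hw).fun_pow k)
    exact (hq w hw).fun_mul h

theorem abs_det_restrictScalars {n : ℕ} (A : Cn n →L[ℂ] Cn n) :
    |(A.restrictScalars ℝ).det| = ‖LinearMap.det (A : Cn n →ₗ[ℂ] Cn n)‖ ^ 2 := by
  have h : (A.restrictScalars ℝ).det = Algebra.norm ℝ (LinearMap.det (A : Cn n →ₗ[ℂ] Cn n)) := by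
    rw [← LinearMap.det_restrictScalars]
    rfl
  rw [h, Algebra.norm_complex_eq]
  change |Complex.normSq _| = _
  rw [Complex.normSq_eq_norm_sq, abs_of_nonneg (sq_nonneg _)]

/-- Under the involution the Jacobian cancels the antiholomorphic factor of the kernel. What remains
is the holomorphic function `g ∘ φ / (1 - ρ w₀)^{n+1}`, whose mean is its value at 0, namely `g (ρ
e₀)`. -/
theorem integral_div_one_sub_inner_single_pow {n : ℕ} [NeZero n] {ρ : ℝ} (h0 : 0 ≤ ρ) (h1 : ρ < 1)
    {g : Cn n → ℂ} (hg : DifferentiableOn ℂ g (unitBall n)) (hgi : Integrable g (ballVolume n)) :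
    ∫ w, g w / (1 - inner ℂ w (EuclideanSpace.single 0 (ρ : ℂ))) ^ (n + 1) ∂(ballVolume n) =
      volume.real (unitBall n) • g (EuclideanSpace.single 0 (ρ : ℂ)) := by
  have hz : ‖(EuclideanSpace.single 0 (ρ : ℂ) : Cn n)‖ < 1 := by
    simpa [abs_of_nonneg h0] using h1
  set F : Cn n → ℂ := fun w => g w / (1 - inner ℂ w (EuclideanSpace.single 0 (ρ : ℂ))) ^ (n + 1)
    with hF
  have hFi : IntegrableOn F (unitBall n) := integrable_div_one_sub_inner_pow hz hgi (n + 1)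
  set H : Cn n → ℂ := fun w => g (ballInvolution ρ w) / (1 - (ρ : ℂ) * w 0) ^ (n + 1) with hH
  have hder : ∀ w ∈ unitBall n, HasFDerivWithinAt (ballInvolution ρ)
      ((ballInvolutionDeriv ρ w).restrictScalars ℝ) (unitBall n) w := fun w hw =>
    ((hasFDerivAt_ballInvolution h0 h1 (by simpa using hw)).restrictScalars ℝ).hasFDerivWithinAt
  have hJ : ∀ w ∈ unitBall n,
      |((ballInvolutionDeriv ρ w).restrictScalars ℝ).det| • F (ballInvolution ρ w) = H w := by
    intro w hw
    have hw' : ‖w‖ < 1 := by simpa using hw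
    have ha := one_sub_mul_coord_ne_zero h0 h1 hw'
    rw [abs_det_restrictScalars, det_ballInvolutionDeriv h0 h1 hw', hF, hH]
    simp only
    have hin : 1 - inner ℂ (ballInvolution ρ w) (EuclideanSpace.single 0 (ρ : ℂ)) =
        (1 - (ρ : ℂ) ^ 2) * (conj (1 - (ρ : ℂ) * w 0))⁻¹ := by
      have h := congrArg conj (one_sub_mul_ballInvolution h0 h1 hw')
      rw [EuclideanSpace.inner_single_right]
      simpa using h
    have hs := one_sub_sq_complex_ne_zero h0 h1
    have hc : conj (1 - (ρ : ℂ) * w 0) ≠ 0 := (map_ne_zero _).2 ha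
    rw [hin, Complex.real_smul, Complex.ofReal_pow, Complex.ofReal_div, Complex.ofReal_pow,
      ← Complex.mul_conj']
    push_cast
    set a := 1 - (ρ : ℂ) * w 0
    rw [div_pow, mul_pow, mul_pow, inv_pow]
    field_simp
  have hHd : DifferentiableOn ℂ H (unitBall n) := by
    have hφ : DifferentiableOn ℂ (ballInvolution ρ : Cn n → Cn n) (unitBall n) := fun w hw =>
      (hasFDerivAt_ballInvolution h0 h1 (by simpa using hw)).differentiableAt.differentiableWithinAt
    have hd : DifferentiableOn ℂ (fun w : Cn n => 1 - (ρ : ℂ) * w 0) (unitBall n) :=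
      (((EuclideanSpace.proj 0 : Cn n →L[ℂ] ℂ).differentiable.const_mul (ρ : ℂ)).const_sub
        1).differentiableOn
    exact differentiableOn_div_pow (hg.comp hφ fun w hw => ballInvolution_mem h0 h1 hw) hd
      (fun w hw => one_sub_mul_coord_ne_zero h0 h1 (by simpa using hw)) (n + 1)
  have hHi : IntegrableOn H (unitBall n) := by
    rw [← ballInvolution_image (n := n) h0 h1, integrableOn_image_iff_integrableOn_abs_det_fderiv_smul
      volume measurableSet_ball hder (ballInvolution_injOn h0 h1)] at hFi
    exact hFi.congr_fun hJ measurableSet_ball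
  calc ∫ w, F w ∂(ballVolume n) = ∫ w in ballInvolution ρ '' unitBall n, F w := by
        rw [ballInvolution_image h0 h1]
    _ = ∫ w in unitBall n, H w := by
        rw [integral_image_eq_integral_abs_det_fderiv_smul volume measurableSet_ball hder
          (ballInvolution_injOn h0 h1)]
        exact setIntegral_congr_fun measurableSet_ball hJ
    _ = volume.real (unitBall n) • H 0 := integral_ball_of_differentiableOn hHd hHi
    _ = _ := by simp [hH, ballInvolution]

/-- The Bergman integral reproduces integrable holomorphic functions. -/
theorem bergmanIntegral_eq_of_differentiableOn {n : ℕ} [NeZero n] {g : Cn n → ℂ}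
    (hg : DifferentiableOn ℂ g (unitBall n)) (hgi : Integrable g (ballVolume n)) {z : Cn n}
    (hz : ‖z‖ < 1) : bergmanIntegral n g z = g z := by
  obtain ⟨U, hU⟩ := exists_unitary_apply_eq_single z
  have hpre : U.symm ⁻¹' unitBall n = unitBall n := by ext w; simp
  have hmp : MeasurePreserving U.symm (ballVolume n) (ballVolume n) := by
    have h := (measurePreserving_unitary U.symm).restrict_preimage (s := unitBall n)
      measurableSet_ball
    rwa [hpre] at h
  have hme : MeasurableEmbedding U.symm := U.symm.toHomeomorph.measurableEmbedding
  have h := integral_div_one_sub_inner_single_pow (norm_nonneg z) hz (g := fun w => g (U.symm w))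
    (hg.comp U.symm.toContinuousLinearEquiv.differentiable.differentiableOn fun w hw => by
      simpa using hw) ((hmp.integrable_comp_emb hme).2 hgi)
  have hin : ∀ w, inner ℂ w (EuclideanSpace.single 0 (‖z‖ : ℂ)) = inner ℂ (U.symm w) z := by
    intro w
    rw [← hU, ← U.inner_map_map (U.symm w), U.apply_symm_apply]
  simp_rw [hin] at h
  rw [← hU, U.symm_apply_apply,
    hmp.integral_comp hme (fun v => g v / (1 - inner ℂ v z) ^ (n + 1)),
    volume_real_unitBall] at h
  rw [bergmanIntegral, h, Complex.real_smul]
  have hpi : (Real.pi : ℂ) ≠ 0 := by exact_mod_cast Real.pi_ne_zero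
  have hfac : (n ! : ℂ) ≠ 0 := by exact_mod_cast n.factorial_ne_zero
  push_cast
  field_simp

/-! ### The Bergman projection is the Bergman integral operator -/

/-- The Bergman kernel `w ↦ (n! / πⁿ) / (1 - ⟨w, z⟩) ^ (n + 1)` with pole parameter `z`. -/
noncomputable def bergmanKernel (n : ℕ) (z w : Cn n) : ℂ :=
  ((n ! : ℂ) / (Real.pi : ℂ) ^ n) / (1 - inner ℂ z w) ^ (n + 1)

theorem differentiableOn_inner_right {n : ℕ} (z : Cn n) (s : Set (Cn n)) :
    DifferentiableOn ℂ (fun w => inner ℂ z w) s :=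
  (innerSL ℂ z).differentiable.differentiableOn

theorem differentiableOn_bergmanKernel {n : ℕ} {z : Cn n} (hz : ‖z‖ < 1) :
    DifferentiableOn ℂ (bergmanKernel n z) (unitBall n) :=
  differentiableOn_div_pow (differentiableOn_const _)
    ((differentiableOn_inner_right z _).const_sub 1)
    (fun w hw => one_sub_inner_ne_zero (z := w) (by simpa using hw) hz) (n + 1)

theorem conj_bergmanKernel {n : ℕ} (z w : Cn n) :
    conj (bergmanKernel n z w) = ((n ! : ℂ) / (Real.pi : ℂ) ^ n) / (1 - inner ℂ w z) ^ (n + 1) := by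
  simp [bergmanKernel, inner_conj_symm]

theorem memLp_bergmanKernel {n : ℕ} {z : Cn n} (hz : ‖z‖ < 1) :
    MemLp (bergmanKernel n z) 2 (ballVolume n) := by
  have := isFiniteMeasure_ballVolume n
  refine MemLp.of_bound ((differentiableOn_bergmanKernel hz).continuousOn.aestronglyMeasurable
    measurableSet_ball) (‖(n ! : ℂ) / (Real.pi : ℂ) ^ n‖ * ((1 - ‖z‖) ^ (n + 1))⁻¹) ?_
  filter_upwards [ae_norm_lt_one n] with w hw
  rw [← RCLike.norm_conj, conj_bergmanKernel, div_eq_mul_inv, norm_mul]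
  gcongr
  exact norm_inv_one_sub_inner_pow_le hz hw _

theorem bergmanIntegral_congr {n : ℕ} {f g : Cn n → ℂ} (h : f =ᵐ[ballVolume n] g) (z : Cn n) :
    bergmanIntegral n f z = bergmanIntegral n g z := by
  unfold bergmanIntegral
  congr 1
  refine integral_congr_ae ?_
  filter_upwards [h] with w hw
  rw [hw]

/-- Exhibits evaluation of the Bergman integral at `z` as a continuous functional on `L²`, so it
passes to limits and interacts with the projection by self-adjointness. -/
theorem inner_bergmanKernel {n : ℕ} {z : Cn n} (hz : ‖z‖ < 1) (f : BallL2 n) :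
    inner ℂ ((memLp_bergmanKernel hz).toLp (bergmanKernel n z)) f = bergmanIntegral n f z := by
  rw [L2.inner_def, bergmanIntegral, ← integral_const_mul]
  refine integral_congr_ae ?_
  filter_upwards [(memLp_bergmanKernel hz).coeFn_toLp] with w hw
  rw [hw, RCLike.inner_apply, conj_bergmanKernel]
  ring

theorem bergmanKernel_mem_bergmanSpace {n : ℕ} {z : Cn n} (hz : ‖z‖ < 1) :
    (memLp_bergmanKernel hz).toLp (bergmanKernel n z) ∈ bergmanSpace n :=
  ⟨_, differentiableOn_bergmanKernel hz, (memLp_bergmanKernel hz).coeFn_toLp⟩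

theorem coeFn_ae_eq_bergmanIntegral_of_mem {n : ℕ} [NeZero n] {f : BallL2 n}
    (hf : f ∈ bergmanSpace n) : f =ᵐ[ballVolume n] bergmanIntegral n f := by
  have := isFiniteMeasure_ballVolume n
  obtain ⟨g, hg, hfg⟩ := hf
  have hgi : Integrable g (ballVolume n) := ((Lp.memLp f).integrable one_le_two).congr hfg
  filter_upwards [hfg, ae_norm_lt_one n] with z hz hz1
  rw [bergmanIntegral_congr hfg, bergmanIntegral_eq_of_differentiableOn hg hgi hz1, hz]

/-- A subsequence of an `L²`-convergent sequence converges almost everywhere, while its Bergman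
integrals converge at every point of the ball. Closedness of the Bergman space need not be proved.
-/
theorem coeFn_ae_eq_bergmanIntegral_of_mem_closure {n : ℕ} [NeZero n] {f : BallL2 n}
    (hf : f ∈ (bergmanSpace n).topologicalClosure) : f =ᵐ[ballVolume n] bergmanIntegral n f := by
  obtain ⟨u, hu, hlim⟩ := mem_closure_iff_seq_limit.1
    (show f ∈ closure (bergmanSpace n : Set (BallL2 n)) from hf)
  obtain ⟨ns, hns, hae⟩ := (tendstoInMeasure_of_tendsto_Lp hlim).exists_seq_tendsto_ae
  have hrep : ∀ᵐ z ∂(ballVolume n), ∀ k, u k z = bergmanIntegral n (u k) z :=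
    ae_all_iff.2 fun k => coeFn_ae_eq_bergmanIntegral_of_mem (hu k)
  filter_upwards [hae, hrep, ae_norm_lt_one n] with z hz hzr hz1
  refine tendsto_nhds_unique hz ?_
  simp_rw [hzr, ← inner_bergmanKernel hz1]
  exact (Filter.Tendsto.inner tendsto_const_nhds hlim).comp hns.tendsto_atTop

/-- The orthogonal projection onto the Bergman space is given by the Bergman integral. -/
theorem bergmanProjection_ae_eq {n : ℕ} [NeZero n] (f : BallL2 n) :
    bergmanProjection n f =ᵐ[ballVolume n] bergmanIntegral n f := by
  filter_upwards [coeFn_ae_eq_bergmanIntegral_of_mem_closure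
    (Submodule.starProjection_apply_mem (bergmanSpace n).topologicalClosure f),
    ae_norm_lt_one n] with z hz hz1
  -- `⟨K_z, P f⟩ = ⟨P K_z, f⟩ = ⟨K_z, f⟩`, since the kernel lies in the Bergman space.
  rw [bergmanProjection, hz, ← inner_bergmanKernel hz1,
    ← Submodule.inner_starProjection_left_eq_right, Submodule.starProjection_eq_self_iff.2
      ((bergmanSpace n).le_topologicalClosure (bergmanKernel_mem_bergmanSpace hz1)),
    inner_bergmanKernel hz1]

theorem commutatorL2_ae_eq {n : ℕ} [NeZero n] {a f : Cn n → ℂ} (hf : MemLp f 2 (ballVolume n))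
    (haf : MemLp (fun z => a z * f z) 2 (ballVolume n)) :
    commutatorL2 n a f hf haf =ᵐ[ballVolume n] commutatorL1 n a f := by
  filter_upwards [bergmanProjection_ae_eq (hf.toLp f),
    bergmanProjection_ae_eq (haf.toLp fun z => a z * f z)] with z h1 h2
  rw [commutatorL2, commutatorL1, h1, h2, bergmanIntegral_congr hf.coeFn_toLp,
    bergmanIntegral_congr haf.coeFn_toLp]

theorem WeakBound.congr_ae {n : ℕ} {C : ℝ} {f T S : Cn n → ℂ} (h : WeakBound n C f T)
    (hTS : S =ᵐ[ballVolume n] T) : WeakBound n C f S := by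
  intro t ht
  refine le_trans (measure_mono_ae ?_) (h t ht)
  filter_upwards [hTS] with z hz hzS
  change t < ‖T z‖
  rw [← hz]
  exact hzS

theorem CommutatorWeakTypeL1.commutatorWeakTypeL2 {n : ℕ} [NeZero n] {a : Cn n → ℂ}
    (h : CommutatorWeakTypeL1 n a) : CommutatorWeakTypeL2 n a := by
  have := isFiniteMeasure_ballVolume n
  obtain ⟨C, hC, hw⟩ := h
  exact ⟨C, hC, fun f hf haf => (hw f (hf.integrable one_le_two)
    (haf.integrable one_le_two)).congr_ae (commutatorL2_ae_eq hf haf)⟩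

/-! ### Bounded symbols -/

theorem enorm_bergmanIntegral_le {n : ℕ} (f : Cn n → ℂ) {z : Cn n} (hz : ‖z‖ < 1) :
    ‖bergmanIntegral n f z‖ₑ ≤ ‖(n ! : ℂ) / (Real.pi : ℂ) ^ n‖ₑ *
      bergmanPositive (fun w => ‖f w‖ₑ) z := by
  rw [bergmanIntegral, enorm_mul]
  gcongr
  refine (enorm_integral_le_lintegral_enorm _).trans_eq (lintegral_congr_ae ?_)
  filter_upwards [ae_norm_lt_one n] with w hw
  have hp := hermGauge_pos hz hw
  rw [← ofReal_norm, ← ofReal_norm, norm_div, norm_pow, div_eq_inv_mul,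
    ENNReal.ofReal_mul (by positivity)]
  congr 1
  exact ENNReal.ofReal_inv_of_pos (pow_pos hp _)

/-- The Bergman integral operator is of weak type (1,1). -/
theorem exists_weakBound_bergmanIntegral (n : ℕ) [NeZero n] : ∃ C : ℝ, 0 < C ∧
    ∀ f : Cn n → ℂ, Integrable f (ballVolume n) → WeakBound n C f (bergmanIntegral n f) := by
  obtain ⟨C, hC, hw⟩ := exists_weakType_bergmanPositive n
  have hC' : (0 : ℝ) < C := hC
  obtain ⟨K, hK⟩ : ∃ K : ℝ, K = ‖(n ! : ℂ) / (Real.pi : ℂ) ^ n‖ := ⟨_, rfl⟩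
  have hK0 : 0 < K := by
    rw [hK, norm_pos_iff]
    have hpi : (Real.pi : ℂ) ≠ 0 := by exact_mod_cast Real.pi_ne_zero
    have hfac : (n ! : ℂ) ≠ 0 := by exact_mod_cast n.factorial_ne_zero
    positivity
  refine ⟨C * K, by positivity, fun f hf t ht => ?_⟩
  -- The bound for the positive operator is stated for measurable functions, hence the passage to a
  -- measurable representative.
  set f' := hf.aestronglyMeasurable.mk f with hf'
  have hff' : f =ᵐ[ballVolume n] f' := hf.aestronglyMeasurable.ae_eq_mk
  have hm : Measurable fun w => ‖f' w‖ₑ :=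
    hf.aestronglyMeasurable.stronglyMeasurable_mk.measurable.enorm
  have hI : ∫⁻ w, ‖f w‖ₑ ∂(ballVolume n) = ∫⁻ w, ‖f' w‖ₑ ∂(ballVolume n) :=
    lintegral_congr_ae (hff'.fun_comp fun x => ‖x‖ₑ)
  have h1 := hw _ hm (t / K) (by positivity)
  have hsub : ballVolume n {z | t < ‖bergmanIntegral n f z‖} ≤
      ballVolume n {z | ENNReal.ofReal (t / K) < bergmanPositive (fun w => ‖f' w‖ₑ) z} := by
    refine measure_mono_ae ?_
    filter_upwards [ae_norm_lt_one n] with z hz hzt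
    have h2 : t < ‖bergmanIntegral n f z‖ := hzt
    rw [bergmanIntegral_congr hff'] at h2
    have h3 := enorm_bergmanIntegral_le f' hz
    rw [← ofReal_norm, ← ofReal_norm, ← hK] at h3
    have h4 := ((ENNReal.ofReal_lt_ofReal_iff (ht.trans h2)).2 h2).trans_le h3
    have h5 : t = K * (t / K) := by field_simp
    rw [h5, ENNReal.ofReal_mul hK0.le] at h4
    exact lt_of_mul_lt_mul_left' h4
  have hC2 : ENNReal.ofReal (C * K / t) = ENNReal.ofReal (t / K)⁻¹ * C := by
    rw [← ENNReal.ofReal_coe_nnreal, ← ENNReal.ofReal_mul (by positivity)]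
    congr 1
    field_simp
  rw [hI, hC2, mul_assoc]
  refine hsub.trans ?_
  calc _ = ENNReal.ofReal (t / K)⁻¹ * (ENNReal.ofReal (t / K) * ballVolume n
        {z | ENNReal.ofReal (t / K) < bergmanPositive (fun w => ‖f' w‖ₑ) z}) := by
        rw [← mul_assoc, ← ENNReal.ofReal_mul (by positivity),
          inv_mul_cancel₀ (by positivity), ENNReal.ofReal_one, one_mul]
    _ ≤ _ := mul_le_mul_right h1 _

theorem commutatorWeakTypeL1_of_bounded {n : ℕ} [NeZero n] {a : Cn n → ℂ} {M : ℝ}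
    (ha : ∀ z ∈ unitBall n, ‖a z‖ ≤ M) : CommutatorWeakTypeL1 n a := by
  obtain ⟨C, hC, hw⟩ := exists_weakBound_bergmanIntegral n
  obtain ⟨N, hN0, hN⟩ : ∃ N : ℝ, 0 < N ∧ ∀ z ∈ unitBall n, ‖a z‖ ≤ N :=
    ⟨|M| + 1, by positivity, fun z hz => (ha z hz).trans (by linarith [le_abs_self M])⟩
  refine ⟨4 * C * N, by positivity, fun f hf haf t ht => ?_⟩
  -- Each term of the commutator is allotted `t / 2`. Both estimates cost `2 C N / t`, whence the
  -- constant `4 C N`.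
  have h1 := hw f hf (t / (2 * N)) (by positivity)
  have h2 := hw _ haf (t / 2) (by positivity)
  have hsub : ballVolume n {z | t < ‖commutatorL1 n a f z‖} ≤
      ballVolume n ({z | t / (2 * N) < ‖bergmanIntegral n f z‖} ∪
        {z | t / 2 < ‖bergmanIntegral n (fun w => a w * f w) z‖}) := by
    refine measure_mono_ae ?_
    filter_upwards [ae_norm_lt_one n] with z hz hzt
    by_contra hcon
    replace hcon := not_or.1 hcon
    have h3 : ‖bergmanIntegral n f z‖ ≤ t / (2 * N) := not_lt.1 hcon.1
    have h4 : ‖bergmanIntegral n (fun w => a w * f w) z‖ ≤ t / 2 := not_lt.1 hcon.2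
    have h5 : t < ‖commutatorL1 n a f z‖ := hzt
    have h6 : ‖commutatorL1 n a f z‖ ≤ N * (t / (2 * N)) + t / 2 := by
      refine (norm_sub_le _ _).trans (add_le_add ?_ h4)
      rw [norm_mul]
      exact mul_le_mul (hN z (by simpa using hz)) h3 (norm_nonneg _) hN0.le
    have h7 : N * (t / (2 * N)) = t / 2 := by field_simp
    linarith
  have haI : ∫⁻ w, ‖a w * f w‖ₑ ∂(ballVolume n) ≤
      ENNReal.ofReal N * ∫⁻ w, ‖f w‖ₑ ∂(ballVolume n) := by
    rw [← lintegral_const_mul' _ _ ENNReal.ofReal_ne_top]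
    refine lintegral_mono_ae ?_
    filter_upwards [ae_norm_lt_one n] with w hw
    rw [enorm_mul, ← ofReal_norm (a w)]
    gcongr
    exact hN w (by simpa using hw)
  calc _ ≤ _ := hsub.trans (measure_union_le _ _)
    _ ≤ ENNReal.ofReal (C / (t / (2 * N))) * ∫⁻ w, ‖f w‖ₑ ∂(ballVolume n) +
        ENNReal.ofReal (C / (t / 2)) * (ENNReal.ofReal N * ∫⁻ w, ‖f w‖ₑ ∂(ballVolume n)) :=
      add_le_add h1 (h2.trans (mul_le_mul_right haI _))
    _ = _ := by
      rw [← mul_assoc, ← add_mul, ← ENNReal.ofReal_mul (by positivity),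
        ← ENNReal.ofReal_add (by positivity) (by positivity)]
      congr 2
      field_simp
      ring

/-! ### Necessity of boundedness -/

/-- The kernel is antiholomorphic in `w`, so against `conj q` the integrand is the conjugate of a
holomorphic function and the mean value property evaluates it exactly. -/
theorem bergmanIntegral_indicator_conj {n : ℕ} {a : Cn n} {ε : ℝ}
    (hsub : closedBall a ε ⊆ unitBall n) {q : Cn n → ℂ} (hq : DifferentiableOn ℂ q (unitBall n))
    {z : Cn n} (hz : ‖z‖ < 1) :
    bergmanIntegral n ((ball a ε).indicator fun w => conj (q w)) z =
      ((n ! : ℂ) / (Real.pi : ℂ) ^ n) *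
        (volume.real (ball a ε) * (conj (q a) / (1 - inner ℂ a z) ^ (n + 1))) := by
  set H : Cn n → ℂ := fun w => q w / (1 - inner ℂ z w) ^ (n + 1) with hH
  have hHd : DifferentiableOn ℂ H (unitBall n) :=
    differentiableOn_div_pow hq ((differentiableOn_inner_right z _).const_sub 1)
      (fun w hw => one_sub_inner_ne_zero (z := w) (by simpa using hw) hz) (n + 1)
  have hHc : ∀ w, conj (H w) = conj (q w) / (1 - inner ℂ w z) ^ (n + 1) := fun w => by
    simp [hH, inner_conj_symm]
  have hmean := integral_ball_of_differentiableOn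
    (hHd.mono (ball_subset_closedBall.trans hsub))
    (((hHd.continuousOn.mono hsub).integrableOn_compact (isCompact_closedBall a ε)).mono_set
      ball_subset_closedBall)
  rw [bergmanIntegral]
  congr 1
  calc _ = ∫ w, (ball a ε).indicator (fun w => conj (H w)) w ∂(ballVolume n) := by
        refine integral_congr_ae (ae_of_all _ fun w => ?_)
        by_cases hw : w ∈ ball a ε <;> simp only [Set.indicator_of_mem, Set.indicator_of_notMem, hw,
          not_false_eq_true, hHc, zero_div]
    _ = ∫ w in ball a ε, conj (H w) := by
        rw [integral_indicator measurableSet_ball, Measure.restrict_restrict measurableSet_ball,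
          Set.inter_eq_left.2 (ball_subset_closedBall.trans hsub)]
    _ = conj (volume.real (ball a ε) • H a) := by rw [integral_conj, hmean]
    _ = _ := by rw [Complex.real_smul, map_mul, Complex.conj_ofReal, hHc]

theorem commutatorL1_indicator {n : ℕ} {a : Cn n} {ε : ℝ}
    (hsub : closedBall a ε ⊆ unitBall n) {b : Cn n → ℂ} (hb : DifferentiableOn ℂ b (unitBall n))
    {z : Cn n} (hz : ‖z‖ < 1) :
    commutatorL1 n (fun z => conj (b z)) ((ball a ε).indicator fun _ => 1) z =
      ((n ! : ℂ) / (Real.pi : ℂ) ^ n) *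
        (volume.real (ball a ε) * (conj (b z - b a) / (1 - inner ℂ a z) ^ (n + 1))) := by
  have h1 := bergmanIntegral_indicator_conj hsub (q := fun _ => 1) (differentiableOn_const 1) hz
  have h2 := bergmanIntegral_indicator_conj hsub hb hz
  have e1 : (fun w => conj (b w) * (ball a ε).indicator (fun _ => (1 : ℂ)) w) =
      (ball a ε).indicator fun w => conj (b w) := by
    ext w
    by_cases hw : w ∈ ball a ε <;> simp [hw]
  simp only [map_one] at h1
  rw [commutatorL1, e1, h1, h2, map_sub]
  ring

theorem CommutatorWeakTypeL2.memHInfinity {n : ℕ} [NeZero n] {b : Cn n → ℂ}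
    (hb : DifferentiableOn ℂ b (unitBall n))
    (h : CommutatorWeakTypeL2 n (fun z => conj (b z))) : MemHInfinity n b := by
  have := isFiniteMeasure_ballVolume n
  obtain ⟨C, hC, hw⟩ := h
  have hhalf : closedBall (0 : Cn n) (1 / 2) ⊆ unitBall n :=
    closedBall_subset_ball (by norm_num)
  obtain ⟨M₀, hM₀⟩ := (isCompact_closedBall (0 : Cn n) (1 / 2)).exists_bound_of_continuousOn
    (hb.continuousOn.mono hhalf)
  obtain ⟨K, hK⟩ : ∃ K : ℝ, K = ‖(n ! : ℂ) / (Real.pi : ℂ) ^ n‖ := ⟨_, rfl⟩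
  have hK0 : 0 < K := by
    rw [hK, norm_pos_iff]
    have hpi : (Real.pi : ℂ) ≠ 0 := by exact_mod_cast Real.pi_ne_zero
    have hfac : (n ! : ℂ) ≠ 0 := by exact_mod_cast n.factorial_ne_zero
    positivity
  set m : ℝ := volume.real (ball (0 : Cn n) (1 / 2)) with hm
  have hm0 : 0 < m := ENNReal.toReal_pos (measure_ball_pos _ _ (by norm_num)).ne'
    measure_ball_lt_top.ne
  -- `M₀` bounds `b` on the half ball, and `2^(n+1)` bounds the denominator of the commutator, as
  -- the gauge is at most 2. The level `2 C / m` is twice what the weak bound permits on a set of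
  -- volume `m`.
  refine ⟨hb, M₀ + 2 ^ (n + 1) * (2 * C / m) / K, fun a ha => ?_⟩
  by_contra! hcon
  have ha1 : ‖a‖ < 1 := by simpa using ha
  set ε : ℝ := (1 - ‖a‖) / 2 with hε
  have hε0 : 0 < ε := by linarith
  have hsub : closedBall a ε ⊆ unitBall n :=
    closedBall_subset_ball' (by rw [dist_zero_right]; linarith)
  set V : ℝ := volume.real (ball a ε) with hV
  have hV0 : 0 < V := ENNReal.toReal_pos (measure_ball_pos _ _ hε0).ne' measure_ball_lt_top.ne
  set f : Cn n → ℂ := (ball a ε).indicator fun _ => 1 with hfdef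
  have hf : MemLp f 2 (ballVolume n) := (memLp_const 1).indicator measurableSet_ball
  obtain ⟨Mb, hMb⟩ := (isCompact_closedBall a ε).exists_bound_of_continuousOn
    (hb.continuousOn.mono hsub)
  have haf : MemLp (fun z => conj (b z) * f z) 2 (ballVolume n) := by
    refine MemLp.of_bound ((Complex.continuous_conj.comp_aestronglyMeasurable
      (hb.continuousOn.aestronglyMeasurable measurableSet_ball)).mul hf.aestronglyMeasurable)
      (max Mb 0) (ae_of_all _ fun w => ?_)
    by_cases hw : w ∈ ball a ε
    · simpa [f, hw] using Or.inl (hMb w (ball_subset_closedBall hw))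
    · simp [f, hw]
  have hbound := hw f hf haf (V * (2 * C / m)) (by positivity)
  have hfI : ∫⁻ w, ‖f w‖ₑ ∂(ballVolume n) = ENNReal.ofReal V := by
    have h1 : (fun w => ‖f w‖ₑ) = (ball a ε).indicator fun _ => 1 := by
      ext w
      by_cases hw : w ∈ ball a ε <;> simp [f, hw]
    rw [h1, lintegral_indicator measurableSet_ball, setLIntegral_one,
      Measure.restrict_apply measurableSet_ball,
      Set.inter_eq_left.2 (ball_subset_closedBall.trans hsub), hV,
      ofReal_measureReal measure_ball_lt_top.ne]
  have hlow : ENNReal.ofReal m ≤ ballVolume n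
      {z | V * (2 * C / m) < ‖commutatorL2 n (fun z => conj (b z)) f hf haf z‖} := by
    have h1 : ENNReal.ofReal m = ballVolume n (ball 0 (1 / 2)) := by
      rw [hm, ofReal_measureReal measure_ball_lt_top.ne, Measure.restrict_apply measurableSet_ball,
        Set.inter_eq_left.2 (ball_subset_closedBall.trans hhalf)]
    rw [h1]
    refine measure_mono_ae ?_
    filter_upwards [commutatorL2_ae_eq hf haf, ae_norm_lt_one n] with z hz hz1 hzh
    change _ < ‖_‖
    rw [hz, commutatorL1_indicator hsub hb hz1, norm_mul, norm_mul, norm_div (conj _), norm_pow,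
      RCLike.norm_conj, ← hK, Complex.norm_real, Real.norm_of_nonneg hV0.le]
    have hg : ‖1 - inner ℂ a z‖ ≤ 2 := hermGauge_le_two hz1 ha1
    have hg0 : 0 < ‖1 - inner ℂ a z‖ := hermGauge_pos hz1 ha1
    have hbz := hM₀ z (ball_subset_closedBall hzh)
    have hdiff : 2 ^ (n + 1) * (2 * C / m) / K < ‖b z - b a‖ := by
      have := norm_sub_norm_le (b a) (b z)
      rw [norm_sub_rev] at this
      linarith
    have h2 : 2 * C / m < K * (‖b z - b a‖ / ‖1 - inner ℂ a z‖ ^ (n + 1)) := by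
      rw [div_lt_iff₀ hK0] at hdiff
      rw [← mul_div_assoc, lt_div_iff₀ (pow_pos hg0 _)]
      have h3 := pow_le_pow_left₀ hg0.le hg (n + 1)
      have h4 : 0 < 2 * C / m := by positivity
      nlinarith
    calc V * (2 * C / m) < V * (K * (‖b z - b a‖ / ‖1 - inner ℂ a z‖ ^ (n + 1))) := by gcongr
      _ = _ := by ring
  have hfinal := hlow.trans hbound
  rw [hfI, ← ENNReal.ofReal_mul (by positivity), ENNReal.ofReal_le_ofReal_iff (by positivity)]
    at hfinal
  -- The volume of the test ball cancels, so the bound on `b` is uniform in `a`; the contradiction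
  -- is `m ≤ m / 2`.
  have : C / (V * (2 * C / m)) * V = m / 2 := by field_simp
  linarith

theorem theoremC (n : ℕ) (hn : 1 ≤ n) (b : Cn n → ℂ)
    (hb : DifferentiableOn ℂ b (unitBall n)) :
    List.TFAE [
      CommutatorWeakTypeL2 n (fun z => conj (b z)),
      CommutatorWeakTypeL1 n (fun z => conj (b z)),
      MemHInfinity n b] := by
  have : NeZero n := ⟨by omega⟩
  tfae_have 2 → 1 := fun h => h.commutatorWeakTypeL2
  tfae_have 1 → 3 := fun h => h.memHInfinity hb
  tfae_have 3 → 2 := fun ⟨_, M, hM⟩ =>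
    commutatorWeakTypeL1_of_bounded (M := M) fun z hz => (RCLike.norm_conj (b z)).trans_le (hM z hz)
  tfae_finish
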